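/- Let $0<c_1<c_0<1$ and $\gamma>0$. Consider the system $\partial_t U=L(\partial_x)U+N(U)$ for $U=(u,v)$, where $$L(\partial_x)\begin{pmatrix}u\\v\end{pmatrix}=\begin{pmatrix}\partial_x^2u\\-(1+\partial_x^2)^2v\end{pmatrix},\qquad N\begin{pmatrix}u\\v\end{pmatrix}=\begin{pmatrix}\tfrac12(u-c_0)(1-u^2)+v\\ \alpha v-v^3-\gamma v(1-u^2)\end{pmatrix},\qquad \alpha=\varepsilon^2,$$ and its front $U_h(y)=(h(y),0)$, $h(y)=\tanh(y/2)$, $y=x-c_0t$. For $\beta>0$ let $\Lambda_\beta$ be the linearization about the front in the frame moving with speed $c_0$, conjugated by the weight $e^{\beta y}$ (that is, acting on $\tilde U=e^{\beta y}U$): $$\Lambda_\beta=L(\partial_y-\beta)+c_0(\partial_y-\beta)+DN(U_h),\qquad DN(U_h)=\begin{pmatrix}\tfrac12(1+2c_0h-3h^2)&1\\0&\varepsilon^2-\gamma(1-h^2)\end{pmatrix},$$ as an unbounded operator in $L^2(\mathbb R;\mathbb C)^2$ with domain $H^2(\mathbb R)\times H^4(\mathbb R)$. Then there exists $\beta_0>0$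 (depending only on $c_0,c_1,\gamma$) such that for every $\beta\in(0,\beta_0)$ there exists $\nu>0$ (depending on $\beta$, but not on $\varepsilon$) such that, for all real $\varepsilon$ with $\varepsilon^2\le c_1\beta$, the spectrum of $\Lambda_\beta$ satisfies $$\Sigma(\Lambda_\beta)\subset\{0\}\cup\{z\in\mathbb C\mid \mathrm{Re}\,z\le-2\nu\}.$$ Moreover $0$ is an eigenvalue of $\Lambda_\beta$, and its eigenspace is spanned by the translation mode $e^{\beta y}U_h'(y)=(e^{\beta y}h'(y),0)$. -/

import Mathlib

open MeasureTheory
open scoped ENNReal SchwartzMap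

noncomputable section

namespace FrontStability

/-! ### Spectrum of an unbounded operator -/

section Spectrum

variable {E : Type*} [NormedAddCommGroup E] [NormedSpace ℂ E]

/-- `z` is in the resolvent set of the unbounded operator `T` when `z - T : D(T) → E` has a bounded
everywhere defined two-sided inverse `R`. -/
def resolventSet (T : E →ₗ.[ℂ] E) : Set ℂ :=
  {z | ∃ R : E →L[ℂ] E,
    (∀ x : E, ∃ hx : R x ∈ T.domain, z • R x - T ⟨R x, hx⟩ = x) ∧
    (∀ y : T.domain, R (z • (y : E) - T y) = y)}

/-- The spectrum of an unbounded operator. -/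
def spectrum (T : E →ₗ.[ℂ] E) : Set ℂ := (resolventSet T)ᶜ

end Spectrum

/-! ### Sobolev spaces `Hⁿ(ℝ)` and weak derivatives -/

/-- The Hilbert space `L²(ℝ; ℂ)`. -/
abbrev L2 : Type := Lp ℂ 2 (volume : Measure ℝ)

/-- The embedding of `L²(ℝ; ℂ)` into the tempered distributions. -/
abbrev toDist : L2 →L[ℂ] 𝓢'(ℝ, ℂ) := Lp.toTemperedDistributionCLM ℂ volume 2

/-- The distributional derivative on the real line. -/
abbrev distDeriv : 𝓢'(ℝ, ℂ) →L[ℂ] 𝓢'(ℝ, ℂ) := TemperedDistribution.derivCLM ℂ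

theorem toDist_injective : Function.Injective toDist := by
  have h := Lp.ker_toTemperedDistributionCLM_eq_bot (F := ℂ) (μ := (volume : Measure ℝ)) (p := 2)
  exact LinearMap.ker_eq_bot.mp h

/-- `Hⁿ(ℝ)`: the functions in `L²` whose first `n` distributional derivatives are in `L²`. -/
def sobolevH (n : ℕ) : Submodule ℂ L2 where
  carrier := {f | ∀ k ≤ n, ∃ g : L2, distDeriv^[k] (toDist f) = toDist g}
  zero_mem' := fun k _ => ⟨0, by simp only [map_zero, iterate_map_zero]⟩
  add_mem' := by
    intro f₁ f₂ h₁ h₂ k hk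
    obtain ⟨g₁, hg₁⟩ := h₁ k hk
    obtain ⟨g₂, hg₂⟩ := h₂ k hk
    exact ⟨g₁ + g₂, by rw [map_add, iterate_map_add, hg₁, hg₂, map_add]⟩
  smul_mem' := by
    intro c f h k hk
    obtain ⟨g, hg⟩ := h k hk
    refine ⟨c • g, ?_⟩
    rw [map_smul, map_smul, ← hg]
    exact Function.Semiconj.iterate_right (f := fun x : 𝓢'(ℝ, ℂ) => c • x)
      (ga := distDeriv) (gb := distDeriv) (fun x => (map_smul distDeriv c x).symm) k (toDist f)|>.symm

theorem sobolevH_anti {m n : ℕ} (h : m ≤ n) : sobolevH n ≤ sobolevH m :=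
  fun _ hf k hk => hf k (hk.trans h)

/-- The inclusion `Hⁿ ⊆ Hᵐ` for `m ≤ n`. -/
def incl {m n : ℕ} (h : m ≤ n) : sobolevH n →ₗ[ℂ] sobolevH m :=
  Submodule.inclusion (sobolevH_anti h)

theorem exists_weakDeriv {n : ℕ} (f : sobolevH (n + 1)) :
    ∃ g : L2, distDeriv (toDist f) = toDist g :=
  f.2 1 (Nat.le_add_left 1 n)

/-- The weak derivative `∂ : Hⁿ⁺¹ → Hⁿ`. -/
def weakDeriv (n : ℕ) : sobolevH (n + 1) →ₗ[ℂ] sobolevH n where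
  toFun f := ⟨(exists_weakDeriv f).choose, fun k hk => by
    rw [← (exists_weakDeriv f).choose_spec]
    exact f.2 (k + 1) (Nat.succ_le_succ hk)⟩
  map_add' f₁ f₂ := by
    apply Subtype.ext
    apply toDist_injective
    rw [← (exists_weakDeriv (f₁ + f₂)).choose_spec]
    simp only [Submodule.coe_add, map_add, ← (exists_weakDeriv f₁).choose_spec,
      ← (exists_weakDeriv f₂).choose_spec]
  map_smul' c f := by
    apply Subtype.ext
    apply toDist_injective
    rw [← (exists_weakDeriv (c • f)).choose_spec]
    simp only [Submodule.coe_smul, map_smul, RingHom.id_apply,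
      ← (exists_weakDeriv f).choose_spec]

/-- `weakDeriv` is the distributional derivative. -/
theorem toDist_weakDeriv (n : ℕ) (f : sobolevH (n + 1)) :
    toDist (weakDeriv n f : L2) = distDeriv (toDist (f : L2)) :=
  (exists_weakDeriv f).choose_spec.symm

/-- The conjugated derivative `∂ - β : Hⁿ⁺¹ → Hⁿ`. -/
def shiftDeriv (β : ℝ) (n : ℕ) : sobolevH (n + 1) →ₗ[ℂ] sobolevH n :=
  weakDeriv n - (β : ℂ) • incl (Nat.le_succ n)

/-- `(∂ - β)² : Hⁿ⁺² → Hⁿ`. -/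
def shiftDeriv2 (β : ℝ) (n : ℕ) : sobolevH (n + 2) →ₗ[ℂ] sobolevH n :=
  shiftDeriv β n ∘ₗ shiftDeriv β (n + 1)

/-- `1 + (∂ - β)² : Hⁿ⁺² → Hⁿ`. -/
def oneAddShiftDeriv2 (β : ℝ) (n : ℕ) : sobolevH (n + 2) →ₗ[ℂ] sobolevH n :=
  incl (Nat.le_add_right n 2) + shiftDeriv2 β n

/-! ### The model system and its front -/

/-- The reaction term
`N(u, v) = ((u - c₀)(1 - u²)/2 + v, α v - v³ - γ v (1 - u²))`. -/
def reaction (c₀ α γ : ℝ) (U : ℝ × ℝ) : ℝ × ℝ :=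
  (1 / 2 * (U.1 - c₀) * (1 - U.1 ^ 2) + U.2, α * U.2 - U.2 ^ 3 - γ * U.2 * (1 - U.1 ^ 2))

/-- The front profile `h(y) = tanh (y / 2)`; the front is `U_h = (h, 0)`. -/
def front (y : ℝ) : ℝ := Real.tanh (y / 2)

/-- The `(1,1)` entry of `DN(U_h)`. -/
def coeffU (c₀ : ℝ) (y : ℝ) : ℝ := 1 / 2 * (1 + 2 * c₀ * front y - 3 * front y ^ 2)

/-- The `(2,2)` entry of `DN(U_h)`. -/
def coeffV (α γ : ℝ) (y : ℝ) : ℝ := α - γ * (1 - front y ^ 2)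

/-- `DN(U_h(y))` is the matrix with rows `(coeffU, 1)` and `(0, coeffV)`. -/
theorem hasFDerivAt_reaction (c₀ α γ y : ℝ) :
    HasFDerivAt (reaction c₀ α γ)
      (((coeffU c₀ y • ContinuousLinearMap.fst ℝ ℝ ℝ + ContinuousLinearMap.snd ℝ ℝ ℝ).prod
        (coeffV α γ y • ContinuousLinearMap.snd ℝ ℝ ℝ)) : ℝ × ℝ →L[ℝ] ℝ × ℝ)
      (front y, 0) := by
  have h1 : HasFDerivAt (fun U : ℝ × ℝ => U.1) (ContinuousLinearMap.fst ℝ ℝ ℝ) (front y, 0) :=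
    hasFDerivAt_fst
  have h2 : HasFDerivAt (fun U : ℝ × ℝ => U.2) (ContinuousLinearMap.snd ℝ ℝ ℝ) (front y, 0) :=
    hasFDerivAt_snd
  have e1 := (((h1.sub_const c₀).const_mul (1 / 2)).mul ((h1.pow 2).const_sub 1)).add h2
  have e2 := ((h2.const_mul α).sub (h2.pow 3)).sub
    ((h2.const_mul γ).mul ((h1.pow 2).const_sub 1))
  refine (e1.prodMk e2).congr_fderiv ?_
  ext <;> simp [coeffU, coeffV] <;> ring

theorem continuous_front : Continuous front := by
  have h : front = fun y => Real.sinh (y / 2) / Real.cosh (y / 2) := by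
    funext y
    exact Real.tanh_eq_sinh_div_cosh _
  rw [h]
  exact (Real.continuous_sinh.comp (continuous_id.div_const 2)).div
    (Real.continuous_cosh.comp (continuous_id.div_const 2)) (fun y => (Real.cosh_pos _).ne')

theorem abs_front_le (y : ℝ) : |front y| ≤ 1 := (Real.abs_tanh_lt_one _).le

theorem memLp_coeffU (c₀ : ℝ) :
    MemLp (fun y => (coeffU c₀ y : ℂ)) ∞ (volume : Measure ℝ) := by
  have hc : Continuous (fun y => (coeffU c₀ y : ℂ)) := by
    have := continuous_front
    unfold coeffU
    fun_prop
  refine memLp_top_of_bound hc.aestronglyMeasurable (2 + |c₀|) (Filter.Eventually.of_forall ?_)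
  intro y
  rw [Complex.norm_real, Real.norm_eq_abs]
  have h1 := abs_front_le y
  have h2 : |c₀ * front y| ≤ |c₀| := by
    rw [abs_mul]
    exact mul_le_of_le_one_right (abs_nonneg _) h1
  have h3 : front y ^ 2 ≤ 1 := (sq_le_one_iff_abs_le_one _).mpr h1
  have h4 := sq_nonneg (front y)
  have h5 := abs_le.mp h2
  unfold coeffU
  rw [abs_le]
  constructor <;> linarith [h5.1, h5.2]

theorem memLp_coeffV (α γ : ℝ) :
    MemLp (fun y => (coeffV α γ y : ℂ)) ∞ (volume : Measure ℝ) := by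
  have hc : Continuous (fun y => (coeffV α γ y : ℂ)) := by
    have := continuous_front
    unfold coeffV
    fun_prop
  refine memLp_top_of_bound hc.aestronglyMeasurable (|α| + |γ|) (Filter.Eventually.of_forall ?_)
  intro y
  rw [Complex.norm_real, Real.norm_eq_abs]
  have h3 : front y ^ 2 ≤ 1 := (sq_le_one_iff_abs_le_one _).mpr (abs_front_le y)
  have h4 := sq_nonneg (front y)
  have h5 : |1 - front y ^ 2| ≤ 1 := by rw [abs_le]; constructor <;> linarith
  unfold coeffV
  calc |α - γ * (1 - front y ^ 2)| ≤ |α| + |γ * (1 - front y ^ 2)| := abs_sub _ _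
    _ ≤ |α| + |γ| := by
      rw [abs_mul]
      gcongr
      exact mul_le_of_le_one_right (abs_nonneg _) h5

/-- Multiplication by an essentially bounded function, as an operator on `L²`. -/
def mulOp (a : ℝ → ℂ) (ha : MemLp a ∞ (volume : Measure ℝ)) : L2 →ₗ[ℂ] L2 where
  toFun f := (ha.toLp a • f : Lp ℂ 2 (volume : Measure ℝ))
  map_add' f g := MeasureTheory.Lp.add_smul (r := 2) (ha.toLp a) f g
  map_smul' c f := (MeasureTheory.Lp.smul_comm (r := 2) c (ha.toLp a) f).symm

theorem mulOp_apply_ae (a : ℝ → ℂ) (ha : MemLp a ∞ (volume : Measure ℝ)) (f : L2) :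
    ∀ᵐ y : ℝ, mulOp a ha f y = a y * f y := by
  filter_upwards [Lp.coeFn_lpSMul (r := 2) (ha.toLp a) f, ha.coeFn_toLp] with y h1 h2
  have h3 : mulOp a ha f y = (ha.toLp a • f : Lp ℂ 2 (volume : Measure ℝ)) y := rfl
  rw [h3, h1, ← h2]
  rfl

/-! ### The conjugated linearization `Λ_β = L(∂ - β) + c₀ (∂ - β) + DN(U_h)` -/

/-- First component:
`(∂ - β)² u + c₀ (∂ - β) u + (1 + 2 c₀ h - 3 h²)/2 · u + v`, for `u ∈ H²` and `v ∈ H⁴`. -/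
def linU (c₀ β : ℝ) (u : sobolevH 2) (v : sobolevH 4) : L2 :=
  (shiftDeriv2 β 0 u : L2) + (c₀ : ℂ) • (shiftDeriv β 1 u : L2)
    + (mulOp (fun y => (coeffU c₀ y : ℂ)) (memLp_coeffU c₀) (u : L2) + (v : L2))

/-- Second component:
`-(1 + (∂ - β)²)² v + c₀ (∂ - β) v + (α - γ (1 - h²)) v`, for `v ∈ H⁴`. -/
def linV (c₀ α γ β : ℝ) (v : sobolevH 4) : L2 :=
  -(oneAddShiftDeriv2 β 0 (oneAddShiftDeriv2 β 2 v) : L2) + (c₀ : ℂ) • (shiftDeriv β 3 v : L2)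
    + mulOp (fun y => (coeffV α γ y : ℂ)) (memLp_coeffV α γ) (v : L2)

/-- The operator `Λ_β` in `L²(ℝ; ℂ)²`, with domain `H² × H⁴`. -/
def weightedLinearization (c₀ α γ β : ℝ) : (L2 × L2) →ₗ.[ℂ] (L2 × L2) where
  domain := (sobolevH 2).prod (sobolevH 4)
  toFun :=
    { toFun := fun U =>
        (linU c₀ β ⟨U.1.1, U.2.1⟩ ⟨U.1.2, U.2.2⟩, linV c₀ α γ β ⟨U.1.2, U.2.2⟩)
      map_add' := by
        intro U V
        have e1 : (⟨(U + V).1.1, (U + V).2.1⟩ : sobolevH 2)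
            = ⟨U.1.1, U.2.1⟩ + ⟨V.1.1, V.2.1⟩ := rfl
        have e2 : (⟨(U + V).1.2, (U + V).2.2⟩ : sobolevH 4)
            = ⟨U.1.2, U.2.2⟩ + ⟨V.1.2, V.2.2⟩ := rfl
        rw [e1, e2]
        simp only [linU, linV, map_add, Submodule.coe_add, smul_add, neg_add, Prod.mk_add_mk,
          Prod.mk.injEq]
        constructor <;> abel
      map_smul' := by
        intro c U
        have e1 : (⟨(c • U).1.1, (c • U).2.1⟩ : sobolevH 2) = c • ⟨U.1.1, U.2.1⟩ := rfl
        have e2 : (⟨(c • U).1.2, (c • U).2.2⟩ : sobolevH 4) = c • ⟨U.1.2, U.2.2⟩ := rfl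
        rw [e1, e2]
        simp only [linU, linV, map_smul, Submodule.coe_smul, smul_add, smul_neg, Prod.smul_mk,
          RingHom.id_apply, smul_comm c (c₀ : ℂ)] }

end FrontStability

end

noncomputable section

namespace FrontStability

open scoped FourierTransform LineDeriv ContDiff

/-! The operator is block triangular: the second block does not see `u`, so a resolvent for each
diagonal block gives one for `Λ_β` (`weightedLinearization_isResolvent`).

Each block is a constant coefficient operator plus a bounded real potential. The Fourier transform
turns the former into multiplication by its symbol (`constOp_isResolvent`), and a Neumann series
around the midpoint of the range of the potential adds the latter. The resolvent then exists to the
right of the supremum of the real part of the symbol plus the supremum of the potential. In the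
second block this abscissa is at most `ε² - c₀β + 4β² + 8β⁴`, negative for small `β` because `ε² ≤
c₁β < c₀β`.

In the first block the potential takes positive values, and 0 is an eigenvalue. Since `h' = (1 -
h²)/2`, that block factors as `PQ` with `Q = ∂ - β + h` and `P = ∂ - β + c₀ - h`. The swapped
product `QP` has potential `-(1 - 2c₀h + h²)/2 ≤ -(1 - c₀²)/2 < 0`, so the Neumann argument gives it
a spectral gap. Away from 0, resolvents of `QP` yield resolvents of `PQ`
(`coeffU_block_isResolvent`). At 0, `QP` is injective, so `PQf = 0` forces `Qf = 0`, a first order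
equation whose only solutions are the multiples of `e^{βy}h'`
(`exists_smul_modeL2_of_darbouxQ_zero`). -/

/-- `g` is the weak derivative of `f`. -/
def IsWeakDeriv (f g : L2) : Prop := distDeriv (toDist f) = toDist g

theorem IsWeakDeriv.unique {f g g' : L2} (h : IsWeakDeriv f g) (h' : IsWeakDeriv f g') : g = g' :=
  toDist_injective (h.symm.trans h')

theorem IsWeakDeriv.add {f g f' g' : L2} (h : IsWeakDeriv f g) (h' : IsWeakDeriv f' g') :
    IsWeakDeriv (f + f') (g + g') := by
  unfold IsWeakDeriv at *
  rw [map_add, map_add, map_add, h, h']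

theorem IsWeakDeriv.smul {f g : L2} (c : ℂ) (h : IsWeakDeriv f g) :
    IsWeakDeriv (c • f) (c • g) := by
  unfold IsWeakDeriv at *
  rw [map_smul, map_smul, map_smul, h]

theorem IsWeakDeriv.neg {f g : L2} (h : IsWeakDeriv f g) : IsWeakDeriv (-f) (-g) := by
  simpa using h.smul (-1)

theorem IsWeakDeriv.sub {f g f' g' : L2} (h : IsWeakDeriv f g) (h' : IsWeakDeriv f' g') :
    IsWeakDeriv (f - f') (g - g') := by
  simpa [sub_eq_add_neg] using h.add h'.neg

theorem IsWeakDeriv.zero : IsWeakDeriv 0 0 := by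
  unfold IsWeakDeriv
  rw [map_zero, map_zero]

theorem toDist_apply (f : L2) (φ : 𝓢(ℝ, ℂ)) : toDist f φ = ∫ x, φ x * f x := by
  simp [toDist, Lp.toTemperedDistributionCLM_apply, Lp.toTemperedDistribution_apply]

theorem distDeriv_eq_lineDeriv (T : 𝓢'(ℝ, ℂ)) : distDeriv T = ∂_{(1 : ℝ)} T := by
  ext φ
  rw [TemperedDistribution.derivCLM_apply_apply, TemperedDistribution.lineDerivOp_apply_apply]
  congr 1

/-! ### Weak derivatives on the Fourier side. -/

/-- The symbol `2πiξ` of the derivative. -/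
def symb (ξ : ℝ) : ℂ := 2 * Real.pi * Complex.I * ξ

theorem continuous_symb : Continuous symb := by unfold symb; fun_prop

theorem fourier_toDist (f : L2) : 𝓕 (toDist f) = toDist (𝓕 f) :=
  Lp.fourier_toTemperedDistribution_eq f

theorem isWeakDeriv_iff_integral (f g : L2) : IsWeakDeriv f g ↔
    ∀ φ : 𝓢(ℝ, ℂ), ∫ x, φ x * (𝓕 g : L2) x = ∫ x, φ x * (symb x * (𝓕 f : L2) x) := by
  have key : ∀ φ : 𝓢(ℝ, ℂ), 𝓕 (distDeriv (toDist f)) φ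
      = ∫ x, φ x * (symb x * (𝓕 f : L2) x) := by
    intro φ
    rw [distDeriv_eq_lineDeriv, TemperedDistribution.fourier_lineDerivOp_eq, fourier_toDist]
    have hg : (fun x : ℝ => ((inner ℝ x (1 : ℝ) : ℝ) : ℂ)).HasTemperateGrowth := by fun_prop
    simp only [_root_.smul_apply, TemperedDistribution.smulLeftCLM_apply_apply]
    rw [toDist_apply, smul_eq_mul, ← integral_const_mul]
    congr 1
    ext x
    rw [SchwartzMap.smulLeftCLM_apply_apply hg]
    simp [symb]
    ring
  constructor
  · intro h φ
    rw [← key, h, fourier_toDist, toDist_apply]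
  · intro h
    have : 𝓕 (distDeriv (toDist f)) = 𝓕 (toDist g) := by
      ext φ
      rw [key, ← h, fourier_toDist, toDist_apply]
    have h2 := congrArg (fun T : 𝓢'(ℝ, ℂ) => 𝓕⁻ T) this
    simp only [FourierTransform.fourierInv_fourier_eq] at h2
    exact h2

theorem L2.locallyIntegrable (f : L2) : LocallyIntegrable f volume :=
  (Lp.memLp f).locallyIntegrable (by norm_num)

theorem symb_mul_locallyIntegrable (f : L2) : LocallyIntegrable (fun x => symb x * f x) volume :=
  (L2.locallyIntegrable f).continuous_mul continuous_symb

theorem ae_eq_of_integral_schwartz {f g : ℝ → ℂ} (hf : LocallyIntegrable f volume)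
    (hg : LocallyIntegrable g volume)
    (h : ∀ φ : 𝓢(ℝ, ℂ), ∫ x, φ x * f x = ∫ x, φ x * g x) : f =ᵐ[volume] g := by
  refine ae_eq_of_integral_contDiff_smul_eq hf hg fun ψ hψ hc => ?_
  have hc' : HasCompactSupport (fun x => (ψ x : ℂ)) := hc.comp_left Complex.ofReal_zero
  have hs : ContDiff ℝ (⊤ : ℕ∞) (fun x => (ψ x : ℂ)) := Complex.ofRealCLM.contDiff.comp hψ
  have := h (hc'.toSchwartzMap hs)
  simpa [Complex.real_smul] using this

theorem isWeakDeriv_iff_fourier (f g : L2) : IsWeakDeriv f g ↔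
    ∀ᵐ x : ℝ, (𝓕 g : L2) x = symb x * (𝓕 f : L2) x := by
  rw [isWeakDeriv_iff_integral]
  constructor
  · exact fun h => ae_eq_of_integral_schwartz (L2.locallyIntegrable _)
      (symb_mul_locallyIntegrable _) h
  · intro h φ
    refine integral_congr_ae ?_
    filter_upwards [h] with x hx
    rw [hx]

/-! ### Multiplication operators and the product rule. -/

/-- Multiplication by a bounded function as a bounded operator. -/
def mulCLM (a : ℝ → ℂ) (ha : MemLp a ∞ (volume : Measure ℝ)) : L2 →L[ℂ] L2 :=
  (mulOp a ha).mkContinuous ‖ha.toLp a‖ fun f => Lp.norm_smul_le (r := 2) (ha.toLp a) f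

theorem mulCLM_apply_ae (a : ℝ → ℂ) (ha : MemLp a ∞ (volume : Measure ℝ)) (f : L2) :
    ∀ᵐ y : ℝ, mulCLM a ha f y = a y * f y := mulOp_apply_ae a ha f

theorem norm_mulCLM_le (a : ℝ → ℂ) (ha : MemLp a ∞ (volume : Measure ℝ)) {C : ℝ} (hC : 0 ≤ C)
    (h : ∀ y, ‖a y‖ ≤ C) : ‖mulCLM a ha‖ ≤ C := by
  refine ContinuousLinearMap.opNorm_le_bound _ hC fun f => ?_
  refine Lp.norm_le_mul_norm_of_ae_le_mul ?_
  filter_upwards [mulCLM_apply_ae a ha f] with y hy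
  rw [hy, norm_mul]
  gcongr
  exact h y

theorem toDist_mulCLM (a : ℝ → ℂ) (ha : MemLp a ∞ (volume : Measure ℝ))
    (hg : a.HasTemperateGrowth) (f : L2) :
    toDist (mulCLM a ha f) = TemperedDistribution.smulLeftCLM ℂ a (toDist f) := by
  ext φ
  rw [TemperedDistribution.smulLeftCLM_apply_apply, toDist_apply, toDist_apply]
  refine integral_congr_ae ?_
  filter_upwards [mulCLM_apply_ae a ha f] with y hy
  rw [hy, SchwartzMap.smulLeftCLM_apply_apply hg, smul_eq_mul]
  ring

/-- The product rule for weak derivatives. -/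
theorem IsWeakDeriv.mulCLM {a a' : ℝ → ℂ} (ha : MemLp a ∞ (volume : Measure ℝ))
    (ha' : MemLp a' ∞ (volume : Measure ℝ)) (hg : a.HasTemperateGrowth)
    (hg' : a'.HasTemperateGrowth) (hd : ∀ y, HasDerivAt a (a' y) y) {f g : L2}
    (h : IsWeakDeriv f g) :
    IsWeakDeriv (mulCLM a ha f) (mulCLM a' ha' f + FrontStability.mulCLM a ha g) := by
  unfold IsWeakDeriv at *
  rw [map_add, toDist_mulCLM a ha hg, toDist_mulCLM a' ha' hg', toDist_mulCLM a ha hg, ← h]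
  ext φ
  rw [TemperedDistribution.derivCLM_apply_apply, _root_.add_apply,
    TemperedDistribution.smulLeftCLM_apply_apply, TemperedDistribution.smulLeftCLM_apply_apply,
    TemperedDistribution.smulLeftCLM_apply_apply, TemperedDistribution.derivCLM_apply_apply,
    ← map_add]
  congr 1
  ext x
  have e : ⇑(SchwartzMap.smulLeftCLM ℂ a φ) = a * ⇑φ := by
    ext x
    rw [SchwartzMap.smulLeftCLM_apply_apply hg, smul_eq_mul, Pi.mul_apply]
  simp only [SchwartzMap.smulLeftCLM_apply_apply hg, SchwartzMap.smulLeftCLM_apply_apply hg',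
    _root_.neg_apply, _root_.add_apply, SchwartzMap.derivCLM_apply, smul_eq_mul]
  have := ((hd x).mul (φ.differentiableAt.hasDerivAt)).deriv
  rw [e, this]
  ring

/-! ### Iterated weak derivatives and constant coefficient operators -/

open Classical in
/-- The `k`-th weak derivative of an `L²` function, when it exists in `L²`. -/
def iterDeriv (k : ℕ) (f : L2) : L2 :=
  -- The value 0 is a default, never used for `f` in `sobolevH n` with `k ≤ n`.
  if h : ∃ g : L2, distDeriv^[k] (toDist f) = toDist g then h.choose else 0

theorem iterDeriv_eq {k : ℕ} {f g : L2} (h : distDeriv^[k] (toDist f) = toDist g) :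
    iterDeriv k f = g := by
  have h' : ∃ g : L2, distDeriv^[k] (toDist f) = toDist g := ⟨g, h⟩
  unfold iterDeriv
  rw [dif_pos h']
  exact toDist_injective (h'.choose_spec.symm.trans h)

theorem toDist_iterDeriv {n k : ℕ} (hk : k ≤ n) {f : L2} (hf : f ∈ sobolevH n) :
    distDeriv^[k] (toDist f) = toDist (iterDeriv k f) := by
  obtain ⟨g, hg⟩ := hf k hk
  rw [iterDeriv_eq hg, hg]

theorem isWeakDeriv_iterDeriv {n k : ℕ} (hk : k < n) {f : L2} (hf : f ∈ sobolevH n) :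
    IsWeakDeriv (iterDeriv k f) (iterDeriv (k + 1) f) := by
  unfold IsWeakDeriv
  rw [← toDist_iterDeriv hk.le hf, ← toDist_iterDeriv hk hf, Function.iterate_succ_apply']

theorem iterDeriv_zero (f : L2) : iterDeriv 0 f = f := iterDeriv_eq rfl

theorem distDeriv_iterate_of_chain {n : ℕ} {F : ℕ → L2}
    (h : ∀ k < n, IsWeakDeriv (F k) (F (k + 1))) :
    ∀ k ≤ n, distDeriv^[k] (toDist (F 0)) = toDist (F k) := by
  intro k
  induction k with
  | zero => intro _; rfl
  | succ k ih =>
    intro hk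
    rw [Function.iterate_succ_apply', ih (by omega)]
    exact h k (by omega)

theorem mem_sobolevH_of_chain {n : ℕ} {F : ℕ → L2}
    (h : ∀ k < n, IsWeakDeriv (F k) (F (k + 1))) : F 0 ∈ sobolevH n :=
  fun k hk => ⟨F k, distDeriv_iterate_of_chain h k hk⟩

theorem iterDeriv_of_chain {n : ℕ} {F : ℕ → L2}
    (h : ∀ k < n, IsWeakDeriv (F k) (F (k + 1))) {k : ℕ} (hk : k ≤ n) :
    iterDeriv k (F 0) = F k :=
  iterDeriv_eq (distDeriv_iterate_of_chain h k hk)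

theorem iterDeriv_add {n k : ℕ} (hk : k ≤ n) {f g : L2} (hf : f ∈ sobolevH n)
    (hg : g ∈ sobolevH n) : iterDeriv k (f + g) = iterDeriv k f + iterDeriv k g := by
  apply iterDeriv_eq
  rw [map_add, iterate_map_add, toDist_iterDeriv hk hf, toDist_iterDeriv hk hg, map_add]

theorem iterDeriv_smul {n k : ℕ} (hk : k ≤ n) (c : ℂ) {f : L2} (hf : f ∈ sobolevH n) :
    iterDeriv k (c • f) = c • iterDeriv k f := by
  have h : ∀ j ≤ n, distDeriv^[j] (toDist (c • f)) = toDist (c • iterDeriv j f) := by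
    have := distDeriv_iterate_of_chain (F := fun j => c • iterDeriv j f)
      fun j (hj : j < n) => (isWeakDeriv_iterDeriv hj hf).smul c
    simpa only [iterDeriv_zero] using this
  exact iterDeriv_eq (h k hk)

/-- The constant coefficient operator `∑ p k ∂ᵏ` with domain `Hⁿ`. -/
def constOp (n : ℕ) (p : ℕ → ℂ) : L2 →ₗ.[ℂ] L2 where
  domain := sobolevH n
  toFun :=
    { toFun := fun f => ∑ k ∈ Finset.range (n + 1), p k • iterDeriv k (f : L2)
      map_add' := fun f g => by
        rw [← Finset.sum_add_distrib]
        refine Finset.sum_congr rfl fun k hk => ?_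
        rw [Submodule.coe_add, iterDeriv_add (Finset.mem_range_succ_iff.mp hk) f.2 g.2, smul_add]
      map_smul' := fun c f => by
        rw [RingHom.id_apply, Finset.smul_sum]
        refine Finset.sum_congr rfl fun k hk => ?_
        rw [Submodule.coe_smul, iterDeriv_smul (Finset.mem_range_succ_iff.mp hk) c f.2, smul_comm] }

theorem constOp_apply (n : ℕ) (p : ℕ → ℂ) (f : (constOp n p).domain) :
    constOp n p f = ∑ k ∈ Finset.range (n + 1), p k • iterDeriv k (f : L2) := rfl

/-- Describing the graph by a chain of weak derivatives removes the choice hidden in `iterDeriv`;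
later arguments only exhibit or consume such chains. -/
theorem mem_constOp_graph_iff {n : ℕ} {p : ℕ → ℂ} {f g : L2} :
    (f, g) ∈ (constOp n p).graph ↔ ∃ F : ℕ → L2, F 0 = f ∧
      (∀ k < n, IsWeakDeriv (F k) (F (k + 1))) ∧
      g = ∑ k ∈ Finset.range (n + 1), p k • F k := by
  rw [LinearPMap.mem_graph_iff]
  constructor
  · rintro ⟨y, hy, hg⟩
    obtain rfl : (y : L2) = f := hy
    exact ⟨fun k => iterDeriv k y, iterDeriv_zero _,
      fun k hk => isWeakDeriv_iterDeriv hk y.2, hg.symm⟩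
  · rintro ⟨F, rfl, hF, rfl⟩
    refine ⟨⟨F 0, mem_sobolevH_of_chain hF⟩, rfl, ?_⟩
    rw [constOp_apply]
    exact Finset.sum_congr rfl fun k hk => by
      rw [iterDeriv_of_chain hF (Finset.mem_range_succ_iff.mp hk)]

/-! ### Resolvents -/

section Resolvent

variable {E : Type*} [NormedAddCommGroup E] [NormedSpace ℂ E]

/-- `R` is the bounded two-sided inverse of `z - T`. -/
def IsResolvent (T : E →ₗ.[ℂ] E) (z : ℂ) (R : E →L[ℂ] E) : Prop :=
  (∀ x : E, (R x, z • R x - x) ∈ T.graph) ∧ ∀ y g : E, (y, g) ∈ T.graph → R (z • y - g) = y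

theorem mem_resolventSet_iff {T : E →ₗ.[ℂ] E} {z : ℂ} :
    z ∈ resolventSet T ↔ ∃ R, IsResolvent T z R := by
  refine exists_congr fun R => and_congr (forall_congr' fun x => ?_) ?_
  · rw [LinearPMap.mem_graph_iff]
    constructor
    · rintro ⟨hx, h⟩
      refine ⟨⟨R x, hx⟩, rfl, (sub_eq_iff_eq_add.mpr ?_).symm⟩
      rw [add_comm]
      exact sub_eq_iff_eq_add.mp h
    · rintro ⟨y, hy, h⟩
      have hy' : (y : E) = R x := hy
      have hx : R x ∈ T.domain := hy' ▸ y.2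
      have : y = ⟨R x, hx⟩ := Subtype.ext hy'
      refine ⟨hx, ?_⟩
      rw [← this, h]
      simp
  · constructor
    · intro h y g hyg
      obtain ⟨y', hy, hg⟩ := (LinearPMap.mem_graph_iff _).mp hyg
      have := h y'
      simp only at hy hg
      rw [hg, hy] at this
      exact this
    · intro h y
      exact h y (T y) (T.mem_graph y)

theorem mem_vadd_graph_iff {M : E →ₗ[ℂ] E} {T : E →ₗ.[ℂ] E} {f g : E} :
    (f, g) ∈ (M +ᵥ T).graph ↔ (f, g - M f) ∈ T.graph := by
  rw [LinearPMap.mem_graph_iff, LinearPMap.mem_graph_iff]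
  constructor
  · rintro ⟨y', hy, hg⟩
    refine ⟨y', hy, ?_⟩
    rw [LinearPMap.vadd_apply] at hg
    simp only at hy hg ⊢
    rw [← hg, ← hy]
    simp
  · rintro ⟨y', hy, hg⟩
    refine ⟨y', hy, ?_⟩
    rw [LinearPMap.vadd_apply]
    simp only at hy hg ⊢
    rw [hg, hy]
    simp

/-- Bounded perturbations of an operator with a resolvent at a shifted point. -/
theorem IsResolvent.perturb [CompleteSpace E] {T : E →ₗ.[ℂ] E} {w : ℂ} {R : E →L[ℂ] E}
    (hR : IsResolvent T w R) (M : E →L[ℂ] E) (z : ℂ)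
    (h : ‖(M + (w - z) • ContinuousLinearMap.id ℂ E) ∘L R‖ < 1) :
    ∃ R', IsResolvent ((M : E →ₗ[ℂ] E) +ᵥ T) z R' := by
  -- Factor `z - (M + T) = (1 - N R)(w - T)`; the first factor is inverted by a Neumann series, so
  -- the resolvent is `R (1 - N R)⁻¹`.
  set N := (M + (w - z) • ContinuousLinearMap.id ℂ E) with hN
  obtain ⟨u, hu⟩ := isUnit_one_sub_of_norm_lt_one h
  have hu' : ∀ x, x - N (R x) = (u : E →L[ℂ] E) x := fun x => by
    rw [hu]; rfl
  have hl : ∀ x, (↑u⁻¹ : E →L[ℂ] E) ((u : E →L[ℂ] E) x) = x := fun x => by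
    change ((↑u⁻¹ : E →L[ℂ] E) * (u : E →L[ℂ] E)) x = x
    rw [Units.inv_mul]; rfl
  have hr : ∀ x, (u : E →L[ℂ] E) ((↑u⁻¹ : E →L[ℂ] E) x) = x := fun x => by
    change ((u : E →L[ℂ] E) * (↑u⁻¹ : E →L[ℂ] E)) x = x
    rw [Units.mul_inv]; rfl
  refine ⟨R ∘L (↑u⁻¹ : E →L[ℂ] E), fun x => ?_, fun y g hyg => ?_⟩
  · rw [mem_vadd_graph_iff]
    have := hR.1 ((↑u⁻¹ : E →L[ℂ] E) x)
    have e := hu' ((↑u⁻¹ : E →L[ℂ] E) x)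
    rw [hr] at e
    have e2 : z • R ((↑u⁻¹ : E →L[ℂ] E) x) - x - M (R ((↑u⁻¹ : E →L[ℂ] E) x))
        = w • R ((↑u⁻¹ : E →L[ℂ] E) x) - (↑u⁻¹ : E →L[ℂ] E) x := by
      simp only [hN, _root_.add_apply, _root_.smul_apply, ContinuousLinearMap.id_apply] at e
      linear_combination (norm := module) (1 : ℂ) • e
    rw [ContinuousLinearMap.comp_apply, ContinuousLinearMap.coe_coe, e2]
    exact this
  · rw [mem_vadd_graph_iff] at hyg
    rw [ContinuousLinearMap.coe_coe] at hyg
    have h1 := hR.2 _ _ hyg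
    rw [ContinuousLinearMap.comp_apply]
    have e := hu' (w • y - (g - M y))
    rw [h1] at e
    have e2 : z • y - g = (w • y - (g - M y)) - N y := by
      simp only [hN, _root_.add_apply, _root_.smul_apply, ContinuousLinearMap.id_apply]
      module
    rw [e2, e, hl, h1]

/-- If some resolvent exists, bijectivity of `z - T` gives a resolvent at `z`. -/
theorem IsResolvent.of_bijective [CompleteSpace E] {T : E →ₗ.[ℂ] E} {w : ℂ} {S : E →L[ℂ] E}
    (hS : IsResolvent T w S) (z : ℂ) (hinj : ∀ y, (y, z • y) ∈ T.graph → y = 0)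
    (hsurj : ∀ x, ∃ y, (y, z • y - x) ∈ T.graph) : ∃ R, IsResolvent T z R := by
  -- `K = (z - T)(w - T)⁻¹` is bounded and, under the hypotheses, bijective. The open mapping
  -- theorem bounds `K⁻¹`, and the resolvent is `S K⁻¹`.
  set K : E →L[ℂ] E := ContinuousLinearMap.id ℂ E + (z - w) • S with hK
  have hKx : ∀ x, K x = x + (z - w) • S x := fun x => rfl
  have hK1 : ∀ y g, (y, g) ∈ T.graph → K (w • y - g) = z • y - g := by
    intro y g h
    rw [hKx, hS.2 _ _ h]
    module
  have hker : LinearMap.ker (K : E →ₗ[ℂ] E) = ⊥ := by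
    rw [LinearMap.ker_eq_bot']
    intro x hx
    have hx' : x + (z - w) • S x = 0 := hx
    have h1 := hS.1 x
    have h2 : w • S x - x = z • S x := by
      rw [← sub_eq_zero, ← neg_eq_zero, ← hx']
      module
    rw [h2] at h1
    have h3 := hinj _ h1
    rw [h3] at h2
    simpa using h2
  have hrange : LinearMap.range (K : E →ₗ[ℂ] E) = ⊤ := by
    rw [LinearMap.range_eq_top]
    intro x
    obtain ⟨y, hy⟩ := hsurj x
    refine ⟨_, (hK1 _ _ hy).trans ?_⟩
    abel
  let e := ContinuousLinearEquiv.ofBijective K hker hrange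
  have he : ∀ x, K (e.symm x) = x := fun x => e.apply_symm_apply x
  have he' : ∀ x, e.symm (K x) = x := fun x => e.symm_apply_apply x
  refine ⟨S ∘L (e.symm : E →L[ℂ] E), fun x => ?_, fun y g h => ?_⟩
  · have h1 := hS.1 (e.symm x)
    have h2 := he x
    rw [hKx] at h2
    have h3 : z • S (e.symm x) - x = w • S (e.symm x) - e.symm x := by
      linear_combination (norm := module) (1 : ℂ) • h2
    rw [ContinuousLinearMap.comp_apply, ContinuousLinearEquiv.coe_coe, h3]
    exact h1
  · rw [← hK1 _ _ h, ContinuousLinearMap.comp_apply, ContinuousLinearEquiv.coe_coe, he',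
      hS.2 _ _ h]

end Resolvent

/-! ### Resolvents of constant coefficient operators -/

/-- The Fourier symbol of `∑ p k ∂ᵏ`. -/
def polySymb (n : ℕ) (p : ℕ → ℂ) (ξ : ℝ) : ℂ := ∑ k ∈ Finset.range (n + 1), p k * symb ξ ^ k

theorem continuous_polySymb (n : ℕ) (p : ℕ → ℂ) : Continuous (polySymb n p) := by
  unfold polySymb
  have := continuous_symb
  fun_prop

theorem fourier_sum_ae (s : Finset ℕ) (p : ℕ → ℂ) (F : ℕ → L2) :
    ∀ᵐ x : ℝ, (𝓕 (∑ k ∈ s, p k • F k) : L2) x = ∑ k ∈ s, p k * (𝓕 (F k) : L2) x := by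
  have e : (𝓕 (∑ k ∈ s, p k • F k) : L2) = ∑ k ∈ s, p k • 𝓕 (F k) := by
    have := map_sum (Lp.fourierTransformₗᵢ ℝ ℂ) (fun k => p k • F k) s
    simp only [map_smul] at this
    exact this
  rw [e]
  filter_upwards [Lp.coeFn_finsetSum s (fun k => p k • (𝓕 (F k) : L2)),
    (Filter.eventually_all_finset s).mpr fun k _ => Lp.coeFn_smul (p k) (𝓕 (F k) : L2)] with x h1 h2
  rw [h1, Finset.sum_apply]
  exact Finset.sum_congr rfl fun k hk => by rw [h2 k hk]; rfl

/-- The resolvent is the Fourier multiplier `1 / (z - symbol)`. The bound `h1` gives its norm; the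
ellipticity bound `h2` places its range in `Hⁿ`. -/
theorem constOp_isResolvent (n : ℕ) (p : ℕ → ℂ) (z : ℂ) {δ C : ℝ} (hδ : 0 < δ)
    (h1 : ∀ ξ, δ ≤ ‖z - polySymb n p ξ‖) (h2 : ∀ ξ, ‖symb ξ‖ ^ n ≤ C * ‖z - polySymb n p ξ‖) :
    ∃ R, IsResolvent (constOp n p) z R ∧ ‖R‖ ≤ δ⁻¹ := by
  set d : ℝ → ℂ := fun ξ => z - polySymb n p ξ with hd
  have hd0 : ∀ ξ, d ξ ≠ 0 := fun ξ h => by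
    have := h1 ξ
    rw [show z - polySymb n p ξ = 0 from h, norm_zero] at this
    linarith
  have hdpos : ∀ ξ, 0 < ‖d ξ‖ := fun ξ => norm_pos_iff.mpr (hd0 ξ)
  have hdc : Continuous d := continuous_const.sub (continuous_polySymb n p)
  -- `m k` represents `∂ᵏ` of the resolvent. The truncation `min k n` keeps it bounded for every
  -- `k`, though only `k ≤ n` matters.
  set m : ℕ → ℝ → ℂ := fun k ξ => symb ξ ^ (min k n) / d ξ with hm
  have hmb : ∀ k ξ, ‖m k ξ‖ ≤ δ⁻¹ + C := by
    intro k ξ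
    rw [hm, norm_div, norm_pow, div_le_iff₀ (hdpos ξ)]
    have e1 : ‖symb ξ‖ ^ (min k n) ≤ 1 + ‖symb ξ‖ ^ n := by
      rcases le_total ‖symb ξ‖ 1 with h | h
      · exact (pow_le_one₀ (norm_nonneg _) h).trans (le_add_of_nonneg_right (by positivity))
      · exact (pow_le_pow_right₀ h (min_le_right k n)).trans (by simp)
    have e2 : 1 ≤ δ⁻¹ * ‖d ξ‖ := by
      rw [inv_mul_eq_div, le_div_iff₀ hδ, one_mul]
      exact h1 ξ
    have e3 := h2 ξ
    rw [add_mul]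
    exact e1.trans (add_le_add e2 e3)
  have hmp : ∀ k, MemLp (m k) ∞ (volume : Measure ℝ) := fun k =>
    memLp_top_of_bound (((continuous_symb.pow _).div hdc hd0).aestronglyMeasurable) _
      (Filter.Eventually.of_forall (hmb k))
  set e := Lp.fourierTransformₗᵢ ℝ ℂ with he
  have hFe : ∀ f : L2, (𝓕 f : L2) = e f := fun f => rfl
  set G : ℕ → L2 → L2 := fun k f => e.symm (mulCLM (m k) (hmp k) (e f)) with hG
  have hGF : ∀ k f, ∀ᵐ x : ℝ, (𝓕 (G k f) : L2) x = m k x * (𝓕 f : L2) x := by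
    intro k f
    rw [hFe, hFe, hG]
    simp only [LinearIsometryEquiv.apply_symm_apply]
    exact mulCLM_apply_ae _ _ _
  have hGd : ∀ f, ∀ k < n, IsWeakDeriv (G k f) (G (k + 1) f) := by
    intro f k hk
    rw [isWeakDeriv_iff_fourier]
    filter_upwards [hGF k f, hGF (k + 1) f] with x e1 e2
    rw [e1, e2]
    simp only [hm, min_eq_left hk.le, min_eq_left (show k + 1 ≤ n from hk)]
    ring
  let R : L2 →L[ℂ] L2 := (e.symm.toContinuousLinearEquiv : L2 →L[ℂ] L2) ∘L
    (mulCLM (m 0) (hmp 0)) ∘L (e.toContinuousLinearEquiv : L2 →L[ℂ] L2)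
  have hRG : ∀ f, R f = G 0 f := fun f => rfl
  refine ⟨R, ⟨fun f => ?_, fun y g hyg => ?_⟩, ?_⟩
  · rw [mem_constOp_graph_iff]
    refine ⟨fun k => G k f, (hRG f).symm, hGd f, ?_⟩
    apply e.injective
    apply Lp.ext
    have h3 := fourier_sum_ae (Finset.range (n + 1)) p (fun k => G k f)
    have h4 : e (z • R f - f) = z • e (R f) - e f := by rw [map_sub, map_smul]
    rw [h4]
    filter_upwards [h3, (Filter.eventually_all_finset (Finset.range (n + 1))).mpr
      fun k _ => hGF k f, hGF 0 f, Lp.coeFn_sub (z • e (R f)) (e f), Lp.coeFn_smul z (e (R f))]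
      with x a1 a2 a3 a4 a5
    rw [a4, Pi.sub_apply, a5, Pi.smul_apply, smul_eq_mul]
    rw [← hFe, ← hFe, ← hFe, hRG, a3, a1, Finset.sum_congr rfl fun k hk => by rw [a2 k hk]]
    have a6 : ∑ k ∈ Finset.range (n + 1), p k * (m k x * (𝓕 f : L2) x)
        = polySymb n p x / d x * (𝓕 f : L2) x := by
      rw [polySymb, Finset.sum_div, Finset.sum_mul]
      refine Finset.sum_congr rfl fun k hk => ?_
      simp only [hm, min_eq_left (Finset.mem_range_succ_iff.mp hk)]
      ring
    rw [a6]
    have a7 : polySymb n p x = z - d x := by rw [hd]; ring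
    rw [a7]
    simp only [hm]
    have := hd0 x
    rw [Nat.zero_min, pow_zero]
    field_simp
  · obtain ⟨F, rfl, hF, rfl⟩ := mem_constOp_graph_iff.mp hyg
    apply e.injective
    apply Lp.ext
    have hF' : ∀ k ≤ n, ∀ᵐ x : ℝ, (𝓕 (F k) : L2) x = symb x ^ k * (𝓕 (F 0) : L2) x := by
      intro k
      induction k with
      | zero => intro _; simp
      | succ k ih =>
        intro hk
        filter_upwards [ih (by omega), (isWeakDeriv_iff_fourier _ _).mp (hF k (by omega))]
          with x b1 b2
        rw [b2, b1]
        ring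
    set g := ∑ k ∈ Finset.range (n + 1), p k • F k with hg
    have h4 : e (z • F 0 - g) = z • e (F 0) - e g := by rw [map_sub, map_smul]
    have h3 := fourier_sum_ae (Finset.range (n + 1)) p F
    filter_upwards [h3, (Filter.eventually_all_finset (Finset.range (n + 1))).mpr
      fun k hk => hF' k (Finset.mem_range_succ_iff.mp hk), hGF 0 (z • F 0 - g),
      Lp.coeFn_sub (z • e (F 0)) (e g), Lp.coeFn_smul z (e (F 0))] with x a1 a2 a3 a4 a5
    rw [← hFe, hRG, a3, hFe, h4, a4, Pi.sub_apply, a5, Pi.smul_apply, smul_eq_mul, ← hFe, ← hFe,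
      a1, Finset.sum_congr rfl fun k hk => by rw [a2 k hk]]
    have a6 : ∑ k ∈ Finset.range (n + 1), p k * (symb x ^ k * (𝓕 (F 0) : L2) x)
        = polySymb n p x * (𝓕 (F 0) : L2) x := by
      rw [polySymb, Finset.sum_mul]
      exact Finset.sum_congr rfl fun k _ => by ring
    rw [a6]
    have a7 : polySymb n p x = z - d x := by rw [hd]; ring
    rw [a7]
    simp only [hm]
    have := hd0 x
    rw [Nat.zero_min, pow_zero]
    field_simp
    ring
  · refine ContinuousLinearMap.opNorm_le_bound _ (by positivity) fun f => ?_
    have hb : ‖mulCLM (m 0) (hmp 0)‖ ≤ δ⁻¹ := by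
      refine norm_mulCLM_le _ _ (by positivity) fun ξ => ?_
      simp only [hm, Nat.zero_min, pow_zero, one_div, norm_inv]
      exact inv_anti₀ hδ (h1 ξ)
    rw [hRG, hG]
    simp only [LinearIsometryEquiv.norm_map]
    refine (ContinuousLinearMap.le_of_opNorm_le _ hb _).trans ?_
    rw [LinearIsometryEquiv.norm_map]

/-! ### Perturbation by multiplication operators -/

theorem norm_mulCLM_add_smul_id_le (a : ℝ → ℂ) (ha : MemLp a ∞ (volume : Measure ℝ)) (c : ℂ) {C : ℝ}
    (hC : 0 ≤ C) (h : ∀ y, ‖a y + c‖ ≤ C) :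
    ‖mulCLM a ha + c • ContinuousLinearMap.id ℂ L2‖ ≤ C := by
  refine ContinuousLinearMap.opNorm_le_bound _ hC fun f => ?_
  refine Lp.norm_le_mul_norm_of_ae_le_mul ?_
  have e : (mulCLM a ha + c • ContinuousLinearMap.id ℂ L2) f = mulCLM a ha f + c • f := rfl
  rw [e]
  filter_upwards [mulCLM_apply_ae a ha f, Lp.coeFn_add (mulCLM a ha f) (c • f),
    Lp.coeFn_smul c f] with y h1 h2 h3
  rw [h2, Pi.add_apply, h3, h1, Pi.smul_apply, smul_eq_mul, ← add_mul, norm_mul]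
  gcongr
  exact h y

/-- The shift `w - z` recentres the potential: the Neumann series converges as soon as the
oscillation of `a` about `z - w` is smaller than the distance from `w` to the symbol. -/
theorem mulCLM_vadd_constOp_isResolvent (n : ℕ) (p : ℕ → ℂ) (a : ℝ → ℂ)
    (ha : MemLp a ∞ (volume : Measure ℝ)) (z w : ℂ) {δ C r : ℝ} (hr : 0 ≤ r) (hδ : r < δ)
    (h1 : ∀ ξ, δ ≤ ‖w - polySymb n p ξ‖) (h2 : ∀ ξ, ‖symb ξ‖ ^ n ≤ C * ‖w - polySymb n p ξ‖)
    (h3 : ∀ y, ‖a y + (w - z)‖ ≤ r) :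
    ∃ R, IsResolvent ((mulCLM a ha : L2 →ₗ[ℂ] L2) +ᵥ constOp n p) z R := by
  have hδ0 : 0 < δ := hr.trans_lt hδ
  obtain ⟨R, hR, hRn⟩ := constOp_isResolvent n p w hδ0 h1 h2
  refine hR.perturb _ z ?_
  have h4 := norm_mulCLM_add_smul_id_le a ha (w - z) hr h3
  calc _ ≤ r * δ⁻¹ := (ContinuousLinearMap.opNorm_comp_le _ _).trans (by gcongr)
    _ < 1 := by rwa [← div_eq_mul_inv, div_lt_one hδ0]

/-! ### Multiplication by the front -/

theorem hasDerivAt_front (y : ℝ) : HasDerivAt front ((1 - front y ^ 2) / 2) y := by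
  have h : front = fun y => Real.sinh (y / 2) / Real.cosh (y / 2) := by
    funext y
    exact Real.tanh_eq_sinh_div_cosh _
  have hy : HasDerivAt (fun y : ℝ => y / 2) (1 / 2) y := (hasDerivAt_id y).div_const 2
  have hc := (Real.cosh_pos (y / 2)).ne'
  have := (hy.sinh).div (hy.cosh) hc
  rw [h]
  refine this.congr_deriv ?_
  field_simp

/-- The Riccati equation `h' = (1 - h²)/2` keeps derivatives polynomial in `h`. As `|h| ≤ 1`, all of
them are bounded, which gives temperate growth. -/
theorem exists_iteratedDeriv_front (n : ℕ) :
    ∃ p : Polynomial ℝ, ∀ y, iteratedDeriv n front y = p.eval (front y) := by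
  induction n with
  | zero => exact ⟨Polynomial.X, fun y => by simp⟩
  | succ n ih =>
    obtain ⟨p, hp⟩ := ih
    refine ⟨p.derivative * (Polynomial.C (1 / 2) * (1 - Polynomial.X ^ 2)), fun y => ?_⟩
    rw [iteratedDeriv_succ, funext hp]
    refine ((p.hasDerivAt (front y)).comp y (hasDerivAt_front y)).deriv.trans ?_
    simp only [Polynomial.eval_mul, Polynomial.eval_C, Polynomial.eval_sub, Polynomial.eval_one,
      Polynomial.eval_pow, Polynomial.eval_X]
    ring

theorem contDiff_front : ContDiff ℝ (⊤ : ℕ∞) front := by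
  have h : front = fun y => Real.sinh (y / 2) / Real.cosh (y / 2) := by
    funext y
    exact Real.tanh_eq_sinh_div_cosh _
  rw [h]
  refine ContDiff.div (Real.contDiff_sinh.comp (contDiff_id.div_const 2))
    (Real.contDiff_cosh.comp (contDiff_id.div_const 2)) fun y => (Real.cosh_pos _).ne'

theorem hasTemperateGrowth_front : (fun y => (front y : ℂ)).HasTemperateGrowth := by
  have h : front.HasTemperateGrowth := by
    refine ⟨contDiff_front, fun n => ?_⟩
    obtain ⟨p, hp⟩ := exists_iteratedDeriv_front n
    obtain ⟨C, hC⟩ := (isCompact_Icc (a := (-1 : ℝ)) (b := 1)).exists_bound_of_continuousOn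
      p.continuous.continuousOn
    refine ⟨0, C, fun y => ?_⟩
    rw [norm_iteratedFDeriv_eq_norm_iteratedDeriv, hp, pow_zero, mul_one]
    exact hC _ (abs_le.mp (abs_front_le y))
  exact Function.HasTemperateGrowth.comp Function.Complex.hasTemperateGrowth_ofReal h

theorem memLp_front : MemLp (fun y => (front y : ℂ)) ∞ (volume : Measure ℝ) := by
  refine memLp_top_of_bound (Complex.continuous_ofReal.comp continuous_front).aestronglyMeasurable
    1 (Filter.Eventually.of_forall fun y => ?_)
  rw [Complex.norm_real]
  exact abs_front_le y

/-- Multiplication by the front. -/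
def mulFront : L2 →L[ℂ] L2 := mulCLM (fun y => (front y : ℂ)) memLp_front

theorem mulFront_apply_ae (f : L2) : ∀ᵐ y : ℝ, mulFront f y = front y * f y :=
  mulCLM_apply_ae _ _ f

theorem mulCLM_quadratic {a : ℝ → ℂ} (ha : MemLp a ∞ (volume : Measure ℝ)) (r s t : ℂ)
    (h : ∀ y, a y = r + s * front y + t * front y ^ 2) (f : L2) :
    mulCLM a ha f = r • f + s • mulFront f + t • mulFront (mulFront f) := by
  apply Lp.ext
  filter_upwards [mulCLM_apply_ae a ha f, mulFront_apply_ae f, mulFront_apply_ae (mulFront f),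
    Lp.coeFn_add (r • f + s • mulFront f) (t • mulFront (mulFront f)),
    Lp.coeFn_add (r • f) (s • mulFront f), Lp.coeFn_smul r f, Lp.coeFn_smul s (mulFront f),
    Lp.coeFn_smul t (mulFront (mulFront f))] with y h1 h2 h3 h4 h5 h6 h7 h8
  rw [h1, h4, Pi.add_apply, h5, Pi.add_apply, h6, h7, h8]
  simp only [Pi.smul_apply, smul_eq_mul]
  rw [h3, h2, h y]
  ring

theorem IsWeakDeriv.mulFront {f g : L2} (h : IsWeakDeriv f g) :
    IsWeakDeriv (mulFront f) ((1 / 2 : ℂ) • f - (1 / 2 : ℂ) • FrontStability.mulFront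
      (FrontStability.mulFront f) + FrontStability.mulFront g) := by
  set a' : ℝ → ℂ := fun y => ((1 - front y ^ 2) / 2 : ℝ) with ha'
  have hg' : a'.HasTemperateGrowth := by
    have e : a' = fun y => (1 / 2 : ℂ) * (1 - (front y : ℂ) * (front y : ℂ)) := by
      funext y
      rw [ha']
      push_cast
      ring
    rw [e]
    have := hasTemperateGrowth_front
    exact (Function.HasTemperateGrowth.const _).mul
      ((Function.HasTemperateGrowth.const _).sub (this.mul this))
  have hm' : MemLp a' ∞ (volume : Measure ℝ) := by
    refine memLp_top_of_bound hg'.1.continuous.aestronglyMeasurable 1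
      (Filter.Eventually.of_forall fun y => ?_)
    rw [ha', Complex.norm_real, Real.norm_eq_abs, abs_le]
    have h3 : front y ^ 2 ≤ 1 := (sq_le_one_iff_abs_le_one _).mpr (abs_front_le y)
    constructor <;> nlinarith [sq_nonneg (front y)]
  have := h.mulCLM memLp_front hm' hasTemperateGrowth_front hg'
    fun y => (hasDerivAt_front y).ofReal_comp
  rw [mulCLM_quadratic hm' (1 / 2) 0 (-1 / 2) (fun y => by rw [ha']; push_cast; ring)] at this
  have e : (1 / 2 : ℂ) • f + (0 : ℂ) • FrontStability.mulFront f
      + (-1 / 2 : ℂ) • FrontStability.mulFront (FrontStability.mulFront f)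
      = (1 / 2 : ℂ) • f - (1 / 2 : ℂ) • FrontStability.mulFront (FrontStability.mulFront f) := by
    module
  rw [e] at this
  exact this

/-! ### The diagonal blocks of the linearization -/

/-- The coefficients of `(∂ - β)² + c₀ (∂ - β)`. -/
def coeffsU (c₀ β : ℝ) : ℕ → ℂ
  | 0 => β ^ 2 - c₀ * β
  | 1 => c₀ - 2 * β
  | 2 => 1
  | _ => 0

/-- The coefficients of `-(1 + (∂ - β)²)² + c₀ (∂ - β)`. -/
def coeffsV (c₀ β : ℝ) : ℕ → ℂ
  | 0 => -(1 + β ^ 2) ^ 2 - c₀ * β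
  | 1 => 4 * β * (1 + β ^ 2) + c₀
  | 2 => -(2 * (1 + β ^ 2) + 4 * β ^ 2)
  | 3 => 4 * β
  | 4 => -1
  | _ => 0

/-- The operator `(∂ - β)² + c₀ (∂ - β) + a` with domain `H²`. -/
def opU (c₀ β : ℝ) (a : ℝ → ℂ) (ha : MemLp a ∞ (volume : Measure ℝ)) : L2 →ₗ.[ℂ] L2 :=
  (mulCLM a ha : L2 →ₗ[ℂ] L2) +ᵥ constOp 2 (coeffsU c₀ β)

/-- The operator `-(1 + (∂ - β)²)² + c₀ (∂ - β) + a` with domain `H⁴`. -/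
def opV (c₀ β : ℝ) (a : ℝ → ℂ) (ha : MemLp a ∞ (volume : Measure ℝ)) : L2 →ₗ.[ℂ] L2 :=
  (mulCLM a ha : L2 →ₗ[ℂ] L2) +ᵥ constOp 4 (coeffsV c₀ β)

theorem mem_opU_graph_iff {c₀ β : ℝ} {a : ℝ → ℂ} {ha : MemLp a ∞ (volume : Measure ℝ)} {f g : L2} :
    (f, g) ∈ (opU c₀ β a ha).graph ↔ ∃ f₁ f₂, IsWeakDeriv f f₁ ∧ IsWeakDeriv f₁ f₂ ∧
      g = ((β : ℂ) ^ 2 - c₀ * β) • f + ((c₀ : ℂ) - 2 * β) • f₁ + f₂ + mulCLM a ha f := by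
  rw [opU, mem_vadd_graph_iff, mem_constOp_graph_iff]
  constructor
  · rintro ⟨F, rfl, hF, hg⟩
    refine ⟨F 1, F 2, hF 0 (by norm_num), hF 1 (by norm_num), ?_⟩
    rw [sub_eq_iff_eq_add] at hg
    rw [hg]
    simp [Finset.sum_range_succ, coeffsU]
  · rintro ⟨f₁, f₂, h1, h2, rfl⟩
    refine ⟨fun k => match k with | 0 => f | 1 => f₁ | _ => f₂, rfl, ?_, ?_⟩
    · intro k hk
      interval_cases k
      · exact h1
      · exact h2
    · simp [Finset.sum_range_succ, coeffsU]

theorem mem_opV_graph_iff {c₀ β : ℝ} {a : ℝ → ℂ} {ha : MemLp a ∞ (volume : Measure ℝ)} {f g : L2} :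
    (f, g) ∈ (opV c₀ β a ha).graph ↔ ∃ f₁ f₂ f₃ f₄, IsWeakDeriv f f₁ ∧ IsWeakDeriv f₁ f₂ ∧
      IsWeakDeriv f₂ f₃ ∧ IsWeakDeriv f₃ f₄ ∧
      g = (-(1 + (β : ℂ) ^ 2) ^ 2 - c₀ * β) • f + (4 * β * (1 + (β : ℂ) ^ 2) + c₀) • f₁
        + (-(2 * (1 + (β : ℂ) ^ 2) + 4 * (β : ℂ) ^ 2)) • f₂ + (4 * (β : ℂ)) • f₃ + (-1 : ℂ) • f₄
        + mulCLM a ha f := by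
  rw [opV, mem_vadd_graph_iff, mem_constOp_graph_iff]
  constructor
  · rintro ⟨F, rfl, hF, hg⟩
    refine ⟨F 1, F 2, F 3, F 4, hF 0 (by norm_num), hF 1 (by norm_num), hF 2 (by norm_num),
      hF 3 (by norm_num), ?_⟩
    rw [sub_eq_iff_eq_add] at hg
    rw [hg]
    simp only [Finset.sum_range_succ, Finset.sum_range_zero, zero_add, coeffsV]
    rfl
  · rintro ⟨f₁, f₂, f₃, f₄, h1, h2, h3, h4, rfl⟩
    refine ⟨fun k => match k with | 0 => f | 1 => f₁ | 2 => f₂ | 3 => f₃ | _ => f₄, rfl, ?_, ?_⟩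
    · intro k hk
      interval_cases k
      · exact h1
      · exact h2
      · exact h3
      · exact h4
    · simp only [Finset.sum_range_succ, Finset.sum_range_zero, zero_add, coeffsV]
      exact add_sub_cancel_right _ _

theorem coe_weakDeriv_eq {n : ℕ} {f : sobolevH (n + 1)} {g : L2} (h : IsWeakDeriv f g) :
    (weakDeriv n f : L2) = g :=
  toDist_injective ((toDist_weakDeriv n f).trans h)

theorem coe_shiftDeriv_eq (β : ℝ) {n : ℕ} {f : sobolevH (n + 1)} {g : L2} (h : IsWeakDeriv f g) :
    (shiftDeriv β n f : L2) = g - (β : ℂ) • (f : L2) := by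
  rw [← coe_weakDeriv_eq h]
  rfl

theorem coe_shiftDeriv2_eq (β : ℝ) {n : ℕ} {f : sobolevH (n + 2)} {g k : L2} (h : IsWeakDeriv f g)
    (h' : IsWeakDeriv g k) :
    (shiftDeriv2 β n f : L2) = k - (2 * β : ℂ) • g + (β ^ 2 : ℂ) • (f : L2) := by
  have e := coe_shiftDeriv_eq β h
  have e2 : IsWeakDeriv (shiftDeriv β (n + 1) f : L2) (k - (β : ℂ) • g) := by
    rw [e]
    exact h'.sub (h.smul _)
  change (shiftDeriv β n (shiftDeriv β (n + 1) f) : L2) = _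
  rw [coe_shiftDeriv_eq β e2, e]
  module

theorem coe_oneAddShiftDeriv2_eq (β : ℝ) {n : ℕ} {f : sobolevH (n + 2)} {g k : L2}
    (h : IsWeakDeriv f g) (h' : IsWeakDeriv g k) :
    (oneAddShiftDeriv2 β n f : L2) = k - (2 * β : ℂ) • g + (1 + β ^ 2 : ℂ) • (f : L2) := by
  have e : (oneAddShiftDeriv2 β n f : L2) = f + shiftDeriv2 β n f := rfl
  rw [e, coe_shiftDeriv2_eq β h h']
  module

theorem mem_graph_linU (c₀ β : ℝ) (u : sobolevH 2) (v : sobolevH 4) :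
    ((u : L2), linU c₀ β u v - v) ∈
      (opU c₀ β (fun y => (coeffU c₀ y : ℂ)) (memLp_coeffU c₀)).graph := by
  rw [mem_opU_graph_iff]
  have h1 := isWeakDeriv_iterDeriv (k := 0) (by norm_num) u.2
  have h2 := isWeakDeriv_iterDeriv (k := 1) (by norm_num) u.2
  rw [iterDeriv_zero] at h1
  refine ⟨_, _, h1, h2, ?_⟩
  rw [linU, coe_shiftDeriv2_eq β h1 h2, coe_shiftDeriv_eq β h1]
  change _ + _ + (mulCLM _ _ _ + _) - _ = _
  module

theorem mem_graph_linV (c₀ α γ β : ℝ) (v : sobolevH 4) :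
    ((v : L2), linV c₀ α γ β v) ∈
      (opV c₀ β (fun y => (coeffV α γ y : ℂ)) (memLp_coeffV α γ)).graph := by
  rw [mem_opV_graph_iff]
  have h1 := isWeakDeriv_iterDeriv (k := 0) (by norm_num) v.2
  have h2 := isWeakDeriv_iterDeriv (k := 1) (by norm_num) v.2
  have h3 := isWeakDeriv_iterDeriv (k := 2) (by norm_num) v.2
  have h4 := isWeakDeriv_iterDeriv (k := 3) (by norm_num) v.2
  rw [iterDeriv_zero] at h1
  refine ⟨_, _, _, _, h1, h2, h3, h4, ?_⟩
  have e := coe_oneAddShiftDeriv2_eq β (n := 2) h1 h2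
  have e1 := (h3.sub (h2.smul (2 * β : ℂ))).add (h1.smul (1 + β ^ 2 : ℂ))
  simp only [Nat.reduceAdd, zero_add] at e e1
  rw [← e] at e1
  have e2 := (h4.sub (h3.smul (2 * β : ℂ))).add (h2.smul (1 + β ^ 2 : ℂ))
  rw [linV, coe_oneAddShiftDeriv2_eq β e1 e2, coe_shiftDeriv_eq β h1, e]
  change _ + _ + mulCLM _ _ _ = _
  simp only [Nat.reduceAdd]
  module

theorem mem_weightedLinearization_graph_iff {c₀ α γ β : ℝ} {u v f g : L2} :
    ((u, v), (f, g)) ∈ (weightedLinearization c₀ α γ β).graph ↔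
      (u, f - v) ∈ (opU c₀ β (fun y => (coeffU c₀ y : ℂ)) (memLp_coeffU c₀)).graph ∧
      (v, g) ∈ (opV c₀ β (fun y => (coeffV α γ y : ℂ)) (memLp_coeffV α γ)).graph := by
  constructor
  · intro h
    obtain ⟨⟨⟨u', v'⟩, hu, hv⟩, hy, hg⟩ := (LinearPMap.mem_graph_iff _).mp h
    simp only [Prod.mk.injEq] at hy
    obtain ⟨rfl, rfl⟩ := hy
    have e1 : linU c₀ β ⟨u', hu⟩ ⟨v', hv⟩ = f := congrArg Prod.fst hg
    have e2 : linV c₀ α γ β ⟨v', hv⟩ = g := congrArg Prod.snd hg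
    rw [← e1, ← e2]
    exact ⟨mem_graph_linU c₀ β ⟨u', hu⟩ ⟨v', hv⟩, mem_graph_linV c₀ α γ β ⟨v', hv⟩⟩
  · rintro ⟨h1, h2⟩
    have hu : u ∈ sobolevH 2 := LinearPMap.mem_domain_of_mem_graph h1
    have hv : v ∈ sobolevH 4 := LinearPMap.mem_domain_of_mem_graph h2
    have e1 := LinearPMap.mem_graph_snd_inj _ h1 (mem_graph_linU c₀ β ⟨u, hu⟩ ⟨v, hv⟩) rfl
    have e2 := LinearPMap.mem_graph_snd_inj _ h2 (mem_graph_linV c₀ α γ β ⟨v, hv⟩) rfl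
    rw [LinearPMap.mem_graph_iff]
    refine ⟨⟨(u, v), hu, hv⟩, rfl, ?_⟩
    exact Prod.ext (sub_left_injective e1).symm e2.symm

/-! ### Resolvent estimates for the diagonal blocks -/

theorem symb_eq (ξ : ℝ) : symb ξ = ((2 * Real.pi * ξ : ℝ) : ℂ) * Complex.I := by
  unfold symb
  push_cast
  ring

theorem norm_symb_pow (ξ : ℝ) (n : ℕ) : ‖symb ξ‖ ^ n = |2 * Real.pi * ξ| ^ n := by
  rw [symb_eq, norm_mul, Complex.norm_I, mul_one, Complex.norm_real, Real.norm_eq_abs]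

theorem re_polySymb_coeffsU (c₀ β : ℝ) (ξ : ℝ) :
    (polySymb 2 (coeffsU c₀ β) ξ).re = β ^ 2 - c₀ * β - (2 * Real.pi * ξ) ^ 2 := by
  have e : polySymb 2 (coeffsU c₀ β) ξ = ((β ^ 2 - c₀ * β - (2 * Real.pi * ξ) ^ 2 : ℝ) : ℂ)
      + (((c₀ - 2 * β) * (2 * Real.pi * ξ) : ℝ) : ℂ) * Complex.I := by
    simp only [polySymb, Finset.sum_range_succ, Finset.sum_range_zero, zero_add, coeffsU, symb_eq]
    push_cast
    linear_combination (2 * Real.pi * ξ : ℂ) ^ 2 * Complex.I_sq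
  rw [e, Complex.add_re, Complex.ofReal_re, Complex.re_ofReal_mul, Complex.I_re, mul_zero, add_zero]

/-- With `k = 2πξ`, this completes the square in `-(1 + β² - k²)² + 4β²k²`; the maximum exceeds
`-c₀β` by `4β² + 8β⁴`. -/
theorem re_polySymb_coeffsV (c₀ β : ℝ) (ξ : ℝ) :
    (polySymb 4 (coeffsV c₀ β) ξ).re = 4 * β ^ 2 + 8 * β ^ 4 - c₀ * β
      - ((2 * Real.pi * ξ) ^ 2 - (1 + 3 * β ^ 2)) ^ 2 := by
  set k := 2 * Real.pi * ξ with hk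
  have e : polySymb 4 (coeffsV c₀ β) ξ = ((4 * β ^ 2 + 8 * β ^ 4 - c₀ * β
      - (k ^ 2 - (1 + 3 * β ^ 2)) ^ 2 : ℝ) : ℂ)
      + ((((4 * β * (1 + β ^ 2) + c₀) * k) - 4 * β * k ^ 3 : ℝ) : ℂ) * Complex.I := by
    simp only [polySymb, Finset.sum_range_succ, Finset.sum_range_zero, zero_add, coeffsV, symb_eq,
      ← hk]
    push_cast
    have h3 : Complex.I ^ 3 = -Complex.I := Complex.I_pow_three
    have h4 : Complex.I ^ 4 = 1 := Complex.I_pow_four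
    simp only [mul_pow, h3, h4, Complex.I_sq]
    ring
  rw [e, Complex.add_re, Complex.ofReal_re, Complex.re_ofReal_mul, Complex.I_re, mul_zero, add_zero]

theorem opU_isResolvent {c₀ β : ℝ} {a : ℝ → ℂ} (ha : MemLp a ∞ (volume : Measure ℝ)) (z : ℂ)
    {m r : ℝ} (hr : 0 ≤ r) (h : ∀ y, ‖a y + m‖ ≤ r) (hz : r < z.re + m + c₀ * β - β ^ 2) :
    ∃ R, IsResolvent (opU c₀ β a ha) z R := by
  have hre : ∀ ξ, z.re + m + c₀ * β - β ^ 2 + (2 * Real.pi * ξ) ^ 2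
      ≤ ‖z + m - polySymb 2 (coeffsU c₀ β) ξ‖ := by
    intro ξ
    refine le_trans (le_of_eq ?_) (Complex.re_le_norm _)
    rw [Complex.sub_re, re_polySymb_coeffsU]
    simp
    ring
  refine mulCLM_vadd_constOp_isResolvent 2 (coeffsU c₀ β) a ha z (z + m) (C := 1) hr hz
    (fun ξ => ?_) (fun ξ => ?_) fun y => ?_
  · have := hre ξ
    nlinarith [sq_nonneg (2 * Real.pi * ξ)]
  · have := hre ξ
    rw [norm_symb_pow, sq_abs]
    linarith
  · rw [add_sub_cancel_left]
    exact h y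

theorem opV_isResolvent {c₀ β : ℝ} {a : ℝ → ℂ} (ha : MemLp a ∞ (volume : Measure ℝ)) (z : ℂ)
    {m r : ℝ} (hr : 0 ≤ r) (h : ∀ y, ‖a y + m‖ ≤ r)
    (hz : r < z.re + m + c₀ * β - 4 * β ^ 2 - 8 * β ^ 4) :
    ∃ R, IsResolvent (opV c₀ β a ha) z R := by
  set δ := z.re + m + c₀ * β - 4 * β ^ 2 - 8 * β ^ 4 with hδ
  have hδ0 : 0 < δ := hr.trans_lt hz
  have hre : ∀ ξ, δ + ((2 * Real.pi * ξ) ^ 2 - (1 + 3 * β ^ 2)) ^ 2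
      ≤ ‖z + m - polySymb 4 (coeffsV c₀ β) ξ‖ := by
    intro ξ
    refine le_trans (le_of_eq ?_) (Complex.re_le_norm _)
    rw [Complex.sub_re, re_polySymb_coeffsV]
    simp
    ring
  refine mulCLM_vadd_constOp_isResolvent 4 (coeffsV c₀ β) a ha z (z + m)
    -- With `s = (2πξ)²` and `q = 1 + 3β²`, this comes from `s² ≤ 2(s - q)² + 2q²`, the constant
    -- `2q²` being absorbed by the lower bound `δ`.
    (C := 2 + 2 * (1 + 3 * β ^ 2) ^ 2 / δ) hr hz (fun ξ => ?_) (fun ξ => ?_) fun y => ?_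
  · have := hre ξ
    nlinarith [sq_nonneg ((2 * Real.pi * ξ) ^ 2 - (1 + 3 * β ^ 2))]
  · have h5 := hre ξ
    have h6 : |2 * Real.pi * ξ| ^ 4 = ((2 * Real.pi * ξ) ^ 2) ^ 2 := by
      rw [← sq_abs (2 * Real.pi * ξ)]
      ring
    rw [norm_symb_pow, h6]
    set s := (2 * Real.pi * ξ) ^ 2
    set q := 1 + 3 * β ^ 2
    set N := ‖z + m - polySymb 4 (coeffsV c₀ β) ξ‖
    have h7 : s ^ 2 ≤ 2 * (s - q) ^ 2 + 2 * q ^ 2 := by nlinarith [sq_nonneg (s - 2 * q)]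
    have h8 : 2 * q ^ 2 ≤ 2 * q ^ 2 / δ * N := by
      rw [div_mul_eq_mul_div, le_div_iff₀ hδ0]
      have : δ ≤ N := by nlinarith [sq_nonneg (s - q)]
      gcongr
    rw [add_mul]
    nlinarith
  · rw [add_sub_cancel_left]
    exact h y

/-- Back substitution: solve for `v` by `S`, then for `u` by `R` with `v` added to the source. -/
theorem weightedLinearization_isResolvent {c₀ α γ β : ℝ} {z : ℂ} {R S : L2 →L[ℂ] L2}
    (hR : IsResolvent (opU c₀ β (fun y => (coeffU c₀ y : ℂ)) (memLp_coeffU c₀)) z R)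
    (hS : IsResolvent (opV c₀ β (fun y => (coeffV α γ y : ℂ)) (memLp_coeffV α γ)) z S) :
    ∃ T, IsResolvent (weightedLinearization c₀ α γ β) z T := by
  refine ⟨(R ∘L (ContinuousLinearMap.fst ℂ L2 L2 + S ∘L ContinuousLinearMap.snd ℂ L2 L2)).prod
    (S ∘L ContinuousLinearMap.snd ℂ L2 L2), ?_, ?_⟩
  · rintro ⟨f, g⟩
    change ((R (f + S g), S g), (z • R (f + S g) - f, z • S g - g)) ∈ _
    rw [mem_weightedLinearization_graph_iff]
    refine ⟨?_, hS.1 g⟩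
    have := hR.1 (f + S g)
    rwa [← sub_sub] at this
  · rintro ⟨u, v⟩ ⟨f, g⟩ h
    obtain ⟨h1, h2⟩ := mem_weightedLinearization_graph_iff.mp h
    change (R (z • u - f + S (z • v - g)), S (z • v - g)) = (u, v)
    rw [hS.2 _ _ h2]
    have := hR.2 _ _ h1
    rw [← sub_add] at this
    rw [this]

theorem coeffV_block_isResolvent {c₀ α γ β : ℝ} (hγ : 0 < γ) {z : ℂ}
    (hz : 0 < z.re - α + c₀ * β - 4 * β ^ 2 - 8 * β ^ 4) :
    ∃ R, IsResolvent (opV c₀ β (fun y => (coeffV α γ y : ℂ)) (memLp_coeffV α γ)) z R := by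
  -- The potential lies in `[α - γ, α]`; `-m` is the midpoint and `r` the half-length.
  refine opV_isResolvent _ z (m := γ / 2 - α) (r := γ / 2) (by linarith) (fun y => ?_) (by linarith)
  rw [← Complex.ofReal_add, Complex.norm_real, Real.norm_eq_abs, coeffV, abs_le]
  have h3 : front y ^ 2 ≤ 1 := (sq_le_one_iff_abs_le_one _).mpr (abs_front_le y)
  constructor <;> nlinarith [sq_nonneg (front y)]

/-! ### Darboux factorization of the first block -/

/-- `w = (∂ - β + h) f`. -/
def DarbouxQ (β : ℝ) (f w : L2) : Prop :=
  ∃ f₁, IsWeakDeriv f f₁ ∧ w = f₁ - (β : ℂ) • f + mulFront f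

/-- `g = (∂ - β + c₀ - h) w`. -/
def DarbouxP (c₀ β : ℝ) (w g : L2) : Prop :=
  ∃ w₁, IsWeakDeriv w w₁ ∧ g = w₁ + (c₀ - β : ℂ) • w - mulFront w

theorem DarbouxQ.add {β : ℝ} {f w f' w' : L2} (h : DarbouxQ β f w) (h' : DarbouxQ β f' w') :
    DarbouxQ β (f + f') (w + w') := by
  obtain ⟨f₁, h1, rfl⟩ := h
  obtain ⟨f₁', h1', rfl⟩ := h'
  exact ⟨_, h1.add h1', by rw [map_add]; module⟩

theorem DarbouxQ.smul {β : ℝ} {f w : L2} (c : ℂ) (h : DarbouxQ β f w) :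
    DarbouxQ β (c • f) (c • w) := by
  obtain ⟨f₁, h1, rfl⟩ := h
  exact ⟨_, h1.smul c, by rw [map_smul]; module⟩

theorem DarbouxP.smul {c₀ β : ℝ} {f w : L2} (c : ℂ) (h : DarbouxP c₀ β f w) :
    DarbouxP c₀ β (c • f) (c • w) := by
  obtain ⟨f₁, h1, rfl⟩ := h
  exact ⟨_, h1.smul c, by rw [map_smul]; module⟩

theorem DarbouxP.eq_zero {c₀ β : ℝ} {g : L2} (h : DarbouxP c₀ β 0 g) : g = 0 := by
  obtain ⟨w₁, h1, rfl⟩ := h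
  rw [← IsWeakDeriv.zero.unique h1]
  simp

theorem DarbouxQ.zero (β : ℝ) : DarbouxQ β 0 0 := ⟨0, IsWeakDeriv.zero, by simp⟩

/-- The potential `-(1 - 2 c₀ h + h²) / 2` of the Darboux transform of the first block. -/
def dualCoeff (c₀ : ℝ) (y : ℝ) : ℂ := ((-(1 - 2 * c₀ * front y + front y ^ 2) / 2 : ℝ) : ℂ)

/-- For `|h| ≤ 1` the potential ranges in `[-(1 + c₀), -(1 - c₀²)/2]`, with extremes at `h = -1` and
`h = c₀`; the constants are the midpoint (up to sign) and the half-length. -/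
theorem norm_dualCoeff_add_le {c₀ : ℝ} (h0 : 0 < c₀) (h1 : c₀ < 1) (y : ℝ) :
    ‖dualCoeff c₀ y + (((1 - c₀ ^ 2) / 2 + (1 + c₀)) / 2 : ℝ)‖
      ≤ ((1 + c₀) - (1 - c₀ ^ 2) / 2) / 2 := by
  rw [dualCoeff, ← Complex.ofReal_add, Complex.norm_real, Real.norm_eq_abs, abs_le]
  have h3 := abs_le.mp (abs_front_le y)
  constructor
  · nlinarith
  · nlinarith [sq_nonneg (front y - c₀)]

theorem memLp_dualCoeff (c₀ : ℝ) : MemLp (dualCoeff c₀) ∞ (volume : Measure ℝ) := by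
  have hc : Continuous (dualCoeff c₀) := by
    have := continuous_front
    unfold dualCoeff
    fun_prop
  refine memLp_top_of_bound hc.aestronglyMeasurable (2 + |c₀|) (Filter.Eventually.of_forall ?_)
  intro y
  have h3 := abs_le.mp (abs_front_le y)
  have h4 : |c₀ * front y| ≤ |c₀| := by
    rw [abs_mul]
    exact mul_le_of_le_one_right (abs_nonneg _) (abs_front_le y)
  have h5 := abs_le.mp h4
  rw [dualCoeff, Complex.norm_real, Real.norm_eq_abs, abs_le]
  constructor <;> nlinarith

/-- The factorization `PQ`, domains included: when `Qf` has a weak derivative, so do `f' = Qf + βf -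
hf` and hence `f` lies in `H²`. -/
theorem mem_opU_coeffU_graph_iff {c₀ β : ℝ} {f g : L2} :
    (f, g) ∈ (opU c₀ β (fun y => (coeffU c₀ y : ℂ)) (memLp_coeffU c₀)).graph ↔
      ∃ w, DarbouxQ β f w ∧ DarbouxP c₀ β w g := by
  have hM := mulCLM_quadratic (memLp_coeffU c₀) (1 / 2) c₀ (-3 / 2)
    (fun y => by rw [coeffU]; push_cast; ring) f
  rw [mem_opU_graph_iff, hM]
  constructor
  · rintro ⟨f₁, f₂, h1, h2, rfl⟩
    refine ⟨_, ⟨f₁, h1, rfl⟩, _, (h2.sub (h1.smul _)).add h1.mulFront, ?_⟩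
    simp only [map_add, map_sub, map_smul]
    module
  · rintro ⟨w, ⟨f₁, h1, rfl⟩, w₁, hw, rfl⟩
    have h2 := (hw.add (h1.smul (β : ℂ))).sub h1.mulFront
    have e : f₁ - (β : ℂ) • f + mulFront f + (β : ℂ) • f - mulFront f = f₁ := by module
    rw [e] at h2
    refine ⟨f₁, _, h1, h2, ?_⟩
    simp only [map_add, map_sub, map_smul]
    module

/-- Swapping the factors changes the sign of the `h'` term, which makes the potential negative. -/
theorem mem_opU_dualCoeff_graph_iff {c₀ β : ℝ} {f g : L2} :
    (f, g) ∈ (opU c₀ β (dualCoeff c₀) (memLp_dualCoeff c₀)).graph ↔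
      ∃ w, DarbouxP c₀ β f w ∧ DarbouxQ β w g := by
  have hM := mulCLM_quadratic (memLp_dualCoeff c₀) (-1 / 2) c₀ (-1 / 2)
    (fun y => by rw [dualCoeff]; push_cast; ring) f
  rw [mem_opU_graph_iff, hM]
  constructor
  · rintro ⟨f₁, f₂, h1, h2, rfl⟩
    refine ⟨_, ⟨f₁, h1, rfl⟩, _, (h2.add (h1.smul _)).sub h1.mulFront, ?_⟩
    simp only [map_add, map_sub, map_smul]
    module
  · rintro ⟨w, ⟨f₁, h1, rfl⟩, w₁, hw, rfl⟩
    have h2 := (hw.sub (h1.smul (c₀ - β : ℂ))).add h1.mulFront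
    have e : f₁ + (c₀ - β : ℂ) • f - mulFront f - (c₀ - β : ℂ) • f + mulFront f = f₁ := by module
    rw [e] at h2
    refine ⟨f₁, _, h1, h2, ?_⟩
    simp only [map_add, map_sub, map_smul]
    module

theorem dual_isResolvent {c₀ β : ℝ} (h0 : 0 < c₀) (h1 : c₀ < 1) {z : ℂ}
    (hz : 0 < z.re + (1 - c₀ ^ 2) / 2 + c₀ * β - β ^ 2) :
    ∃ R, IsResolvent (opU c₀ β (dualCoeff c₀) (memLp_dualCoeff c₀)) z R :=
  opU_isResolvent _ z (by nlinarith) (norm_dualCoeff_add_le h0 h1) (by linarith)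

/-- A reference point far to the right, needed as input for `IsResolvent.of_bijective`. -/
theorem exists_coeffU_isResolvent (c₀ β : ℝ) :
    ∃ w R, IsResolvent (opU c₀ β (fun y => (coeffU c₀ y : ℂ)) (memLp_coeffU c₀)) w R := by
  refine ⟨((3 + |c₀| - c₀ * β + β ^ 2 : ℝ) : ℂ), opU_isResolvent _ _ (m := 0) (r := 2 + |c₀|)
    (by positivity) (fun y => ?_) ?_⟩
  · rw [Complex.ofReal_zero, add_zero, Complex.norm_real, Real.norm_eq_abs]
    have h3 := abs_le.mp (abs_front_le y)
    have h4 : |c₀ * front y| ≤ |c₀| := by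
      rw [abs_mul]
      exact mul_le_of_le_one_right (abs_nonneg _) (abs_front_le y)
    have h5 := abs_le.mp h4
    rw [coeffU, abs_le]
    constructor <;> nlinarith
  · rw [Complex.ofReal_re]
    linarith

/-- If `PQy = zy` then `Qy` is an eigenvector of `QP` for `z`, hence zero, and `zy = P0 = 0`.
Surjectivity comes from the identity `(z - PQ)⁻¹ = z⁻¹(1 + P(z - QP)⁻¹Q)`. -/
theorem coeffU_block_isResolvent {c₀ β : ℝ} (h0 : 0 < c₀) (h1 : c₀ < 1) {z : ℂ} (hz0 : z ≠ 0)
    (hz : 0 < z.re + (1 - c₀ ^ 2) / 2 + c₀ * β - β ^ 2) :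
    ∃ R, IsResolvent (opU c₀ β (fun y => (coeffU c₀ y : ℂ)) (memLp_coeffU c₀)) z R := by
  obtain ⟨D, hD⟩ := dual_isResolvent (β := β) h0 h1 hz
  obtain ⟨w, S, hS⟩ := exists_coeffU_isResolvent c₀ β
  refine hS.of_bijective z (fun y hy => ?_) fun f => ?_
  · obtain ⟨q, hQ, hP⟩ := mem_opU_coeffU_graph_iff.mp hy
    have hq : q = 0 := by
      have := hD.2 q (z • q) (mem_opU_dualCoeff_graph_iff.mpr ⟨_, hP, hQ.smul z⟩)
      rw [← this, sub_self, map_zero]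
    subst hq
    exact (smul_eq_zero.mp hP.eq_zero).resolve_left hz0
  -- `Q` cannot be applied to a general `f` in `L²`, so the identity is applied to the regularized
  -- `f₁ = S f`.
  · set f₁ := S f with hf₁
    have hf := hS.1 f
    obtain ⟨q, hQ, hP⟩ := mem_opU_coeffU_graph_iff.mp hf
    obtain ⟨x, hPx, hQx⟩ := mem_opU_dualCoeff_graph_iff.mp (hD.1 q)
    have h2 : DarbouxQ β (f₁ + x) (z • D q) := by
      convert hQ.add hQx using 1
      module
    have h3 : (f₁ + x, z • x) ∈ (opU c₀ β (fun y => (coeffU c₀ y : ℂ)) (memLp_coeffU c₀)).graph :=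
      mem_opU_coeffU_graph_iff.mpr ⟨_, h2, hPx.smul z⟩
    -- Here `(z - PQ)(f₁ + x) = z f₁` and `(z - PQ) f₁ = f - (w - z) f₁`; this combination cancels
    -- the `f₁` terms.
    refine ⟨f₁ + ((w - z) / z) • (f₁ + x), ?_⟩
    convert Submodule.add_mem _ hf (Submodule.smul_mem _ ((w - z) / z) h3) using 1
    rw [Prod.smul_mk, Prod.mk_add_mk]
    congr 1
    match_scalars <;> field_simp
    ring

/-- `Qf` is in the kernel of `QP`, which is trivial because 0 lies in its resolvent set. -/
theorem darbouxQ_eq_zero_of_mem_graph {c₀ β : ℝ} (h0 : 0 < c₀) (h1 : c₀ < 1)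
    (hβ : 0 < (1 - c₀ ^ 2) / 2 + c₀ * β - β ^ 2) {f : L2}
    (hf : (f, 0) ∈ (opU c₀ β (fun y => (coeffU c₀ y : ℂ)) (memLp_coeffU c₀)).graph) :
    DarbouxQ β f 0 := by
  obtain ⟨D, hD⟩ := dual_isResolvent (β := β) (z := 0) h0 h1 (by simpa using hβ)
  obtain ⟨q, hQ, hP⟩ := mem_opU_coeffU_graph_iff.mp hf
  have := hD.2 q 0 (mem_opU_dualCoeff_graph_iff.mpr ⟨_, hP, DarbouxQ.zero β⟩)
  rw [zero_smul, sub_self, map_zero] at this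
  rwa [this]

theorem mem_graph_of_darbouxQ_zero {c₀ β : ℝ} {f : L2} (hf : DarbouxQ β f 0) :
    (f, 0) ∈ (opU c₀ β (fun y => (coeffU c₀ y : ℂ)) (memLp_coeffU c₀)).graph :=
  mem_opU_coeffU_graph_iff.mpr ⟨0, hf, 0, IsWeakDeriv.zero, by simp⟩

/-! ### The translation mode -/

/-- The weighted translation mode `e^{βy} h'(y)`. -/
def mode (β : ℝ) (y : ℝ) : ℝ := Real.exp (β * y) * ((1 - front y ^ 2) / 2)

theorem mode_eq_deriv (β y : ℝ) : mode β y = Real.exp (β * y) * deriv front y := by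
  rw [mode, (hasDerivAt_front y).deriv]

theorem front_sq_lt_one (y : ℝ) : front y ^ 2 < 1 :=
  (sq_lt_one_iff_abs_lt_one _).mpr (Real.abs_tanh_lt_one _)

theorem mode_pos (β y : ℝ) : 0 < mode β y :=
  mul_pos (Real.exp_pos _) (by linarith [front_sq_lt_one y])

theorem hasDerivAt_mode (β y : ℝ) : HasDerivAt (mode β) ((β - front y) * mode β y) y := by
  have h1 : HasDerivAt (fun y : ℝ => Real.exp (β * y)) (Real.exp (β * y) * (β * 1)) y :=
    ((hasDerivAt_id y).const_mul β).exp
  have h2 := (((hasDerivAt_front y).pow 2).const_sub 1).div_const 2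
  refine (h1.mul h2).congr_deriv ?_
  rw [mode, Pi.pow_apply]
  push_cast
  ring

theorem contDiff_mode (β : ℝ) : ContDiff ℝ ∞ (mode β) := by
  have := contDiff_front
  unfold mode
  fun_prop

theorem one_sub_front_sq_le (y : ℝ) : 1 - front y ^ 2 ≤ 4 * Real.exp (-y) := by
  have hc := Real.cosh_pos (y / 2)
  have e : 1 - front y ^ 2 = 1 / Real.cosh (y / 2) ^ 2 := by
    rw [front, Real.tanh_eq_sinh_div_cosh, div_pow, eq_div_iff (by positivity), sub_mul,
      div_mul_cancel₀ _ (by positivity), one_mul, Real.cosh_sq]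
    ring
  have h1 : Real.exp (y / 2) ≤ 2 * Real.cosh (y / 2) := by
    rw [Real.cosh_eq]
    linarith [Real.exp_pos (-(y / 2))]
  have h2 : Real.exp y ≤ 4 * Real.cosh (y / 2) ^ 2 := by
    have e2 : Real.exp y = Real.exp (y / 2) ^ 2 := by
      rw [← Real.exp_nat_mul]
      congr 1
      push_cast
      ring
    rw [e2]
    nlinarith [Real.exp_pos (y / 2)]
  rw [e, Real.exp_neg, div_le_iff₀ (by positivity)]
  have h3 := Real.exp_pos y
  field_simp
  linarith

theorem front_neg (y : ℝ) : front (-y) = -front y := by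
  rw [front, front, neg_div, Real.tanh_neg]

theorem mode_le (β y : ℝ) : mode β y ≤ 2 * Real.exp ((β - 1) * y) := by
  have := one_sub_front_sq_le y
  have e : Real.exp ((β - 1) * y) = Real.exp (β * y) * Real.exp (-y) := by
    rw [← Real.exp_add]
    ring_nf
  rw [e, mode]
  nlinarith [Real.exp_pos (β * y)]

theorem mode_le' (β y : ℝ) : mode β y ≤ 2 * Real.exp ((β + 1) * y) := by
  have := one_sub_front_sq_le (-y)
  rw [front_neg, neg_neg, neg_sq] at this
  have e : Real.exp ((β + 1) * y) = Real.exp (β * y) * Real.exp y := by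
    rw [← Real.exp_add]
    ring_nf
  rw [e, mode]
  nlinarith [Real.exp_pos (β * y)]

/-- The mode is bounded by multiples of `e^{(β-1)y}` on the right and `e^{(β+1)y}` on the left. -/
theorem memLp_mode {β : ℝ} (h0 : 0 < β) (h1 : β < 1) :
    MemLp (fun y => (mode β y : ℂ)) 2 (volume : Measure ℝ) := by
  have hc := (contDiff_mode β).continuous
  have hm : MemLp (mode β) 2 (volume : Measure ℝ) := by
    rw [memLp_two_iff_integrable_sq hc.aestronglyMeasurable]
    have hc2 : Continuous (fun y => mode β y ^ 2) := hc.pow 2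
    have hsq : ∀ (y c : ℝ), mode β y ≤ 2 * Real.exp (c * y) →
        ‖mode β y ^ 2‖ ≤ 4 * Real.exp (2 * c * y) := by
      intro y c h
      have e : Real.exp (2 * c * y) = Real.exp (c * y) ^ 2 := by
        rw [← Real.exp_nat_mul]
        congr 1
        push_cast
        ring
      rw [Real.norm_eq_abs, abs_of_nonneg (by positivity), e]
      nlinarith [mode_pos β y, Real.exp_pos (c * y)]
    rw [← integrableOn_univ, ← Set.Iic_union_Ioi (a := (0 : ℝ))]
    refine IntegrableOn.union ?_ ?_
    · refine Integrable.mono' ((integrableOn_exp_mul_Iic (a := 2 * (β + 1)) (by linarith)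
        0).const_mul 4) hc2.aestronglyMeasurable (Filter.Eventually.of_forall fun y => ?_)
      exact hsq y _ (mode_le' β y)
    · refine Integrable.mono' ((integrableOn_exp_mul_Ioi (a := 2 * (β - 1)) (by linarith)
        0).const_mul 4) hc2.aestronglyMeasurable (Filter.Eventually.of_forall fun y => ?_)
      exact hsq y _ (mode_le β y)
  exact hm.ofReal

/-- The translation mode as an element of `L²`. -/
def modeL2 {β : ℝ} (h0 : 0 < β) (h1 : β < 1) : L2 := (memLp_mode h0 h1).toLp _

theorem modeL2_ae {β : ℝ} (h0 : 0 < β) (h1 : β < 1) :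
    ∀ᵐ y : ℝ, modeL2 h0 h1 y = (mode β y : ℂ) := (memLp_mode h0 h1).coeFn_toLp

theorem smul_sub_mulFront_ae (c : ℂ) (f : L2) :
    ∀ᵐ y : ℝ, (c • f - mulFront f : L2) y = (c - front y) * f y := by
  filter_upwards [Lp.coeFn_sub (c • f) (mulFront f), Lp.coeFn_smul c f, mulFront_apply_ae f]
    with y h1 h2 h3
  rw [h1, Pi.sub_apply, h2, h3, Pi.smul_apply, smul_eq_mul, sub_mul]

/-- The classical equation `mode' = (β - h) mode`, transferred by integration by parts against
Schwartz functions. -/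
theorem isWeakDeriv_modeL2 {β : ℝ} (h0 : 0 < β) (h1 : β < 1) :
    IsWeakDeriv (modeL2 h0 h1) ((β : ℂ) • modeL2 h0 h1 - mulFront (modeL2 h0 h1)) := by
  unfold IsWeakDeriv
  ext φ
  rw [TemperedDistribution.derivCLM_apply_apply, toDist_apply, toDist_apply]
  have hd : ∀ y, HasDerivAt (fun y => (mode β y : ℂ)) ((((β - front y) * mode β y : ℝ)) : ℂ) y :=
    fun y => (hasDerivAt_mode β y).ofReal_comp
  have hφ : ∀ y, HasDerivAt φ (deriv φ y) y := fun y => φ.differentiableAt.hasDerivAt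
  have hm := memLp_mode h0 h1
  have hφ2 : MemLp φ 2 (volume : Measure ℝ) := φ.memLp 2
  have hφ2' : MemLp (fun y => deriv φ y) 2 (volume : Measure ℝ) :=
    (memLp_congr_ae (Filter.Eventually.of_forall fun y => SchwartzMap.derivCLM_apply ℂ φ y)).mp
      ((SchwartzMap.derivCLM ℂ ℂ φ).memLp 2)
  have hm' : MemLp (fun y => (((β - front y) * mode β y : ℝ) : ℂ)) 2 (volume : Measure ℝ) := by
    refine (memLp_congr_ae ?_).mp (Lp.memLp ((β : ℂ) • modeL2 h0 h1 - mulFront (modeL2 h0 h1)))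
    filter_upwards [smul_sub_mulFront_ae β (modeL2 h0 h1), modeL2_ae h0 h1] with y e1 e2
    rw [e1, e2]
    push_cast
    rfl
  have key := integral_mul_deriv_eq_deriv_mul_of_integrable (u := φ) (v := fun y => (mode β y : ℂ))
    (fun y _ => hφ y) (fun y _ => hd y) (hφ2.integrable_mul hm') (hφ2'.integrable_mul hm)
    (hφ2.integrable_mul hm)
  calc _ = ∫ x, -(deriv φ x * (mode β x : ℂ)) := by
        refine integral_congr_ae ?_
        filter_upwards [modeL2_ae h0 h1] with y e2
        rw [e2, _root_.neg_apply, SchwartzMap.derivCLM_apply, neg_mul]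
    _ = _ := by
        rw [integral_neg, ← key]
        refine integral_congr_ae ?_
        filter_upwards [smul_sub_mulFront_ae β (modeL2 h0 h1), modeL2_ae h0 h1] with y e1 e2
        rw [e1, e2]
        push_cast
        rfl

theorem darbouxQ_modeL2 {β : ℝ} (h0 : 0 < β) (h1 : β < 1) : DarbouxQ β (modeL2 h0 h1) 0 :=
  ⟨_, isWeakDeriv_modeL2 h0 h1, by module⟩

/-! ### Uniqueness of the translation mode. -/

/-- A smooth compactly supported function orthogonal to the mode is in the range of the formal
adjoint of `∂ - β + h` on test functions. -/
theorem exists_testFunction_of_integral_mode_eq_zero (β : ℝ) {g : ℝ → ℝ} (hg : ContDiff ℝ ∞ g)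
    (hc : HasCompactSupport g) (h : ∫ y, mode β y * g y = 0) :
    ∃ η : ℝ → ℝ, ContDiff ℝ ∞ η ∧ HasCompactSupport η ∧
      ∀ y, HasDerivAt η (g y - (β - front y) * η y) y := by
  set k : ℝ → ℝ := fun y => mode β y * g y with hk
  have hks : ContDiff ℝ ∞ k := (contDiff_mode β).mul hg
  have hkc : HasCompactSupport k := hc.mul_left
  obtain ⟨r, hr⟩ := hkc.isCompact.isBounded.subset_closedBall 0
  have hk0 : ∀ y, r < |y| → k y = 0 := by
    intro y hy
    by_contra hne
    have := hr (subset_tsupport k hne)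
    rw [Metric.mem_closedBall, dist_zero_right, Real.norm_eq_abs] at this
    linarith
  have hki : Integrable k := hks.continuous.integrable_of_hasCompactSupport hkc
  -- Variation of constants: `η = G / mode` solves the equation. To the right of the support of `k`,
  -- `G` equals the total integral, which vanishes by `h`.
  set G : ℝ → ℝ := fun y => ∫ x in Set.Iic y, k x with hG
  have hGe : ∀ y, G y = (∫ x in (0 : ℝ)..y, k x) + ∫ x in Set.Iic 0, k x := by
    intro y
    have := intervalIntegral.integral_Iic_sub_Iic (a := 0) (b := y) (μ := volume) (f := k)
      hki.integrableOn hki.integrableOn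
    rw [← this]
    simp [hG]
  have hGd : ∀ y, HasDerivAt G (k y) y := by
    intro y
    rw [funext hGe]
    exact (hks.continuous.integral_hasStrictDerivAt 0 y).hasDerivAt.add_const _
  have hGs : ContDiff ℝ ∞ G := by
    rw [contDiff_infty_iff_deriv]
    refine ⟨fun y => (hGd y).differentiableAt, ?_⟩
    rw [funext fun y => (hGd y).deriv]
    exact hks
  have hGc : HasCompactSupport G := by
    refine HasCompactSupport.intro (isCompact_closedBall (0 : ℝ) r) fun y hy => ?_
    rw [Metric.mem_closedBall, dist_zero_right, Real.norm_eq_abs, not_le] at hy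
    rcases le_total y 0 with hy0 | hy0
    · rw [abs_of_nonpos hy0] at hy
      refine setIntegral_eq_zero_of_forall_eq_zero fun x hx => hk0 x ?_
      have hx' : x ≤ y := hx
      exact lt_of_lt_of_le (by linarith) (neg_le_abs x)
    · rw [abs_of_nonneg hy0] at hy
      have e := integral_add_compl (measurableSet_Iic (a := y)) hki
      rw [h, Set.compl_Iic, setIntegral_eq_zero_of_forall_eq_zero (t := Set.Ioi y)
        (fun x hx => hk0 x (lt_of_lt_of_le (hy.trans hx) (le_abs_self x))), add_zero] at e
      exact e
  refine ⟨fun y => G y / mode β y, hGs.div (contDiff_mode β) fun y => (mode_pos β y).ne', ?_, ?_⟩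
  · simp only [div_eq_mul_inv]
    exact hGc.mul_right
  · intro y
    have hp := (mode_pos β y).ne'
    refine ((hGd y).div (hasDerivAt_mode β y) hp).congr_deriv ?_
    simp only [hk]
    field_simp

/-- Write `g = η' + (β - h)η` and test the weak equation `f' = (β - h)f` against `η`. -/
theorem integral_smul_eq_zero_of_darbouxQ_zero {β : ℝ} {f : L2} (hf : DarbouxQ β f 0)
    {g : ℝ → ℝ} (hg : ContDiff ℝ ∞ g) (hc : HasCompactSupport g)
    (h : ∫ y, mode β y * g y = 0) : ∫ y, g y • f y = 0 := by
  obtain ⟨η, hη, hηc, hd⟩ := exists_testFunction_of_integral_mode_eq_zero β hg hc h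
  obtain ⟨f₁, h1, h2⟩ := hf
  have hf₁ : f₁ = (β : ℂ) • f - mulFront f := by
    rw [← sub_eq_zero, h2]
    module
  have hηc' : HasCompactSupport (fun x => (η x : ℂ)) := hηc.comp_left Complex.ofReal_zero
  have hηs : ContDiff ℝ ∞ (fun x => (η x : ℂ)) := Complex.ofRealCLM.contDiff.comp hη
  set φ := hηc'.toSchwartzMap hηs with hφ
  have hφa : ∀ x, φ x = (η x : ℂ) := fun x => rfl
  have hφd : ∀ x, deriv φ x = ((g x - (β - front x) * η x : ℝ) : ℂ) :=
    fun x => (hd x).ofReal_comp.deriv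
  have key := congrArg (fun T : 𝓢'(ℝ, ℂ) => T φ) h1
  simp only [TemperedDistribution.derivCLM_apply_apply, toDist_apply] at key
  have i1 : Integrable (fun x => (-SchwartzMap.derivCLM ℂ ℂ φ) x * f x) :=
    ((-SchwartzMap.derivCLM ℂ ℂ φ).memLp 2).integrable_mul (Lp.memLp f)
  have i2 : Integrable (fun x => φ x * f₁ x) := (φ.memLp 2).integrable_mul (Lp.memLp f₁)
  rw [← sub_eq_zero, ← integral_sub i1 i2] at key
  rw [← neg_eq_zero, ← integral_neg, ← key]
  refine integral_congr_ae ?_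
  filter_upwards [smul_sub_mulFront_ae β f] with x e1
  rw [hf₁, e1, hφa, _root_.neg_apply, SchwartzMap.derivCLM_apply, hφd, Complex.real_smul]
  push_cast
  ring

/-- A du Bois-Reymond argument: `f` annihilates every test function orthogonal to the mode, so it is
proportional to the mode. The bump `χ` fixes the factor. -/
theorem exists_smul_modeL2_of_darbouxQ_zero {β : ℝ} (h0 : 0 < β) (h1 : β < 1) {f : L2}
    (hf : DarbouxQ β f 0) : ∃ c : ℂ, c • modeL2 h0 h1 = f := by
  let χ : ContDiffBump (0 : ℝ) := default
  have hχs : ContDiff ℝ ∞ χ := χ.contDiff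
  have hχc : HasCompactSupport χ := χ.hasCompactSupport
  set K := ∫ y, mode β y * χ y with hK
  have hmc := (contDiff_mode β).continuous
  have hint : ∀ {g : ℝ → ℝ}, ContDiff ℝ ∞ g → HasCompactSupport g →
      Integrable (fun y => mode β y * g y) := fun hg hc =>
    (hmc.mul hg.continuous).integrable_of_hasCompactSupport hc.mul_left
  have hintf : ∀ {g : ℝ → ℝ} (u : L2), ContDiff ℝ ∞ g → HasCompactSupport g →
      Integrable (fun y => g y • u y) := fun u hg hc =>
    (L2.locallyIntegrable u).integrable_smul_left_of_hasCompactSupport hg.continuous hc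
  have hKpos : 0 < K := by
    refine Continuous.integral_pos_of_hasCompactSupport_nonneg_nonzero (x := 0)
      (hmc.mul χ.continuous) hχc.mul_left (fun y => mul_nonneg (mode_pos β y).le χ.nonneg) ?_
    have : χ 0 = 1 := χ.one_of_mem_closedBall (by simp [χ.rIn_pos.le])
    rw [this, mul_one]
    exact (mode_pos β 0).ne'
  set c : ℂ := (∫ y, χ y • f y) / K with hcdef
  refine ⟨c, Lp.ext ?_⟩
  refine ae_eq_of_integral_contDiff_smul_eq (L2.locallyIntegrable _) (L2.locallyIntegrable _)
    fun g hg hgc => ?_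
  set J := ∫ y, mode β y * g y with hJ
  -- Subtracting `(J / K) χ` makes `g` orthogonal to the mode.
  have hz : ∫ y, (g y - J / K * χ y) • f y = 0 := by
    refine integral_smul_eq_zero_of_darbouxQ_zero (β := β) hf (hg.sub (contDiff_const.mul hχs))
      (hgc.sub hχc.mul_left) ?_
    have e : ∀ y, mode β y * (g y - J / K * χ y)
        = mode β y * g y - J / K * (mode β y * χ y) := fun y => by ring
    simp only [e]
    rw [integral_sub (hint hg hgc) ((hint hχs hχc).const_mul _), integral_const_mul, ← hJ, ← hK,
      div_mul_cancel₀ _ hKpos.ne', sub_self]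
  have e2 : ∀ y, (g y - J / K * χ y) • f y = g y • f y - (J / K) • (χ y • f y) := fun y => by
    module
  simp only [e2] at hz
  have hi : Integrable (fun y => (J / K) • χ y • f y) := (hintf f hχs hχc).smul (J / K)
  rw [integral_sub (hintf f hg hgc) hi, integral_smul, sub_eq_zero] at hz
  rw [hz]
  have e3 : ∫ y, g y • (c • modeL2 h0 h1 : L2) y = ∫ y, c * ((mode β y * g y : ℝ) : ℂ) := by
    refine integral_congr_ae ?_
    filter_upwards [Lp.coeFn_smul c (modeL2 h0 h1), modeL2_ae h0 h1] with y e1 e2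
    rw [e1, Pi.smul_apply, e2, Complex.real_smul, smul_eq_mul]
    push_cast
    ring
  rw [e3, integral_const_mul, integral_complex_ofReal, ← hJ, hcdef, Complex.real_smul]
  push_cast
  ring

/-! ### Assembly of the two blocks. -/

theorem mem_resolventSet_weightedLinearization {c₀ α γ β : ℝ} (h0 : 0 < c₀) (h1 : c₀ < 1)
    (hγ : 0 < γ) {z : ℂ} (hz0 : z ≠ 0) (hzU : 0 < z.re + (1 - c₀ ^ 2) / 2 + c₀ * β - β ^ 2)
    (hzV : 0 < z.re - α + c₀ * β - 4 * β ^ 2 - 8 * β ^ 4) :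
    z ∈ resolventSet (weightedLinearization c₀ α γ β) := by
  obtain ⟨R, hR⟩ := coeffU_block_isResolvent h0 h1 hz0 hzU
  obtain ⟨S, hS⟩ := coeffV_block_isResolvent hγ hzV
  exact mem_resolventSet_iff.mpr (weightedLinearization_isResolvent hR hS)

/-- By `hV`, 0 is in the resolvent set of the second block, so kernel elements have `v = 0` and the
question reduces to the first block. -/
theorem exists_mode_span_ker_weightedLinearization {c₀ α γ β : ℝ} (h0 : 0 < c₀) (h1 : c₀ < 1)
    (hγ : 0 < γ) (hβ0 : 0 < β) (hβ1 : β < 1) (hU : 0 < (1 - c₀ ^ 2) / 2 + c₀ * β - β ^ 2)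
    (hV : 0 < -α + c₀ * β - 4 * β ^ 2 - 8 * β ^ 4) :
    ∃ Φ : (weightedLinearization c₀ α γ β).domain,
      (∀ᵐ y : ℝ, (Φ : L2 × L2).1 y = ((Real.exp (β * y) * deriv front y : ℝ) : ℂ)) ∧
      (Φ : L2 × L2).2 = 0 ∧
      LinearMap.ker (weightedLinearization c₀ α γ β).toFun = Submodule.span ℂ {Φ} := by
  have hgraph : ((modeL2 hβ0 hβ1, 0), ((0 : L2), (0 : L2))) ∈
      (weightedLinearization c₀ α γ β).graph := by
    rw [mem_weightedLinearization_graph_iff, sub_zero]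
    exact ⟨mem_graph_of_darbouxQ_zero (darbouxQ_modeL2 hβ0 hβ1), Submodule.zero_mem _⟩
  obtain ⟨Φ, hΦ, hΦ0⟩ := (LinearPMap.mem_graph_iff _).mp hgraph
  have hΦ' : (Φ : L2 × L2) = (modeL2 hβ0 hβ1, 0) := hΦ
  refine ⟨Φ, ?_, by rw [hΦ'], le_antisymm (fun U hU' => ?_) ?_⟩
  · rw [hΦ']
    filter_upwards [modeL2_ae hβ0 hβ1] with y hy
    rw [hy, mode_eq_deriv]
  · have hU0 : weightedLinearization c₀ α γ β U = 0 := LinearMap.mem_ker.mp hU'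
    have hg := (weightedLinearization c₀ α γ β).mem_graph U
    rw [hU0] at hg
    obtain ⟨⟨u, v⟩, hdom⟩ := U
    obtain ⟨hu, hv⟩ := mem_weightedLinearization_graph_iff.mp hg
    obtain ⟨S, hS⟩ := coeffV_block_isResolvent (c₀ := c₀) (α := α) (β := β) (z := 0) hγ
      (by simpa using hV)
    have hv0 : v = 0 := by
      rw [← hS.2 _ _ hv, zero_smul, sub_self, map_zero]
    subst hv0
    rw [sub_self] at hu
    obtain ⟨c, hc⟩ := exists_smul_modeL2_of_darbouxQ_zero hβ0 hβ1
      (darbouxQ_eq_zero_of_mem_graph h0 h1 hU hu)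
    refine Submodule.mem_span_singleton.mpr ⟨c, Subtype.ext ?_⟩
    rw [Submodule.coe_smul, hΦ', Prod.smul_mk, hc, smul_zero]
  · rw [Submodule.span_singleton_le_iff_mem]
    exact LinearMap.mem_ker.mpr hΦ0

end FrontStability

end

theorem proposition2p2 (c₀ c₁ γ : ℝ) (hc₀ : c₀ < 1) (hc₁ : 0 < c₁) (hc : c₁ < c₀) (hγ : 0 < γ) :
    ∃ β₀ : ℝ, 0 < β₀ ∧ ∀ β : ℝ, 0 < β → β < β₀ →
      ∃ ν : ℝ, 0 < ν ∧ ∀ ε : ℝ, ε ^ 2 ≤ c₁ * β →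
        FrontStability.spectrum (FrontStability.weightedLinearization c₀ (ε ^ 2) γ β) ⊆
            {0} ∪ {z : ℂ | z.re ≤ -2 * ν} ∧
        ∃ Φ : (FrontStability.weightedLinearization c₀ (ε ^ 2) γ β).domain,
          (∀ᵐ y : ℝ, (Φ : FrontStability.L2 × FrontStability.L2).1 y =
            ((Real.exp (β * y) * deriv FrontStability.front y : ℝ) : ℂ)) ∧
          (Φ : FrontStability.L2 × FrontStability.L2).2 = 0 ∧
          LinearMap.ker (FrontStability.weightedLinearization c₀ (ε ^ 2) γ β).toFun =
            Submodule.span ℂ {Φ} := by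
  have h0 : 0 < c₀ := hc₁.trans hc
  -- For `β < 1`, `4β² + 8β⁴ ≤ 12β²`, which is below `(c₀ - c₁)β` exactly when `β` is below this
  -- value.
  refine ⟨(c₀ - c₁) / 12, by linarith, fun β hβ hβ' => ?_⟩
  have hβ1 : β < 1 := by linarith
  have hU : 0 < (1 - c₀ ^ 2) / 2 + c₀ * β - β ^ 2 := by nlinarith
  have hV : 0 < (c₀ - c₁) * β - 4 * β ^ 2 - 8 * β ^ 4 := by
    have h4 : β ^ 4 ≤ β ^ 2 := pow_le_pow_of_le_one hβ.le hβ1.le (by norm_num)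
    nlinarith [mul_pos hβ (sub_pos.mpr hβ')]
  set δU := (1 - c₀ ^ 2) / 2 + c₀ * β - β ^ 2 with hδU
  set δV := (c₀ - c₁) * β - 4 * β ^ 2 - 8 * β ^ 4 with hδV
  -- `δU` and `δV` are the gaps of the two blocks; `δV` already uses `ε² ≤ c₁β`, which makes `ν`
  -- independent of `ε`.
  refine ⟨min δU δV / 2, by positivity, fun ε hε => ⟨fun z hz => ?_, ?_⟩⟩
  · by_contra hne
    rw [Set.mem_union, Set.mem_singleton_iff, Set.mem_ofPred_eq, not_or, not_le] at hne
    obtain ⟨hz0, hzre⟩ := hne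
    have hm1 := min_le_left δU δV
    have hm2 := min_le_right δU δV
    refine hz (FrontStability.mem_resolventSet_weightedLinearization h0 hc₀ hγ hz0 ?_ ?_)
    · linarith
    · linarith
  · exact FrontStability.exists_mode_span_ker_weightedLinearization h0 hc₀ hγ hβ hβ1 hU
      (by linarith)
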